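/- Let $T$ be Thompson's group of orientation-preserving homeomorphisms of the circle $\mathbb R/\mathbb Z$ that are piecewise linear with finitely many breakpoints, all of them dyadic, with slopes powers of $2$, and that preserve the set of dyadic rationals; the product is composition, $(vu)(t)=v(u(t))$. Generators. For $n\ge 0$, with $d=2^{-n}$, let $x_n\in T$ be the homeomorphism of $[0,1]$ that is the identity on $[0,1-d]$ and is $t\mapsto \frac{t+1-d}2$, $t\mapsto t-\frac d4$, $t\mapsto 2t-1$ on $[1-d,1-\frac d2]$, $[1-\frac d2,1-\frac d4]$, $[1-\frac d4,1]$. Let $c_n\in T$, of order $n+2$, be the homeomorphism that maps each of the $n+2$ intervals with endpoints $0,\frac12,\frac34,\dots,1-2^{-(n+1)},1$ affinely onto the cyclically preceding one. Diagrams. A marked tree pair diagram $(T_-,T_+)$ consists of two finite rooted binary trees with the same number of leaves (possibly a single leaf) and a mark on one leaf of the target tree $T_+$. Each tree describes a subdivision of $[0,1]$ by repeated halving, one interval for each leaf; the leaves of $T_-$ are numbered $0,1,2,\dots$ from left to right, those of $T_+$ cyclically from left to right with $0$ at the mark. The diagram represents $w\in T$ if $w$ maps the interval of each leaf of $T_-$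 affinely, preserving orientation, onto the interval of the leaf of $T_+$ with the same number. A caret is an inner node together with its two downward edges; it is exposed if both its children are leaves. The diagram is reduced if no exposed caret of $T_-$ has its leaves numbered the same as an exposed caret of $T_+$. Let $N(w)$ be the number of carets of either tree in the reduced diagram of $w$. Normal form. The exponent of a leaf of a tree is the length of the longest path of left edges going up from the leaf that does not reach the right side of the tree (the root and everything joined to it by right edges). With leaves now numbered from left to right in each tree, the normal form of $w$ is the word $$x_{i_1}^{r_1}\cdots x_{i_n}^{r_n}\,c_i^{\,j}\,x_{j_m}^{-s_m}\cdots x_{j_1}^{-s_1},\qquad i_1<\dots<i_n,\quad j_1<\dots<j_m,$$ read off from the reduced diagram $(T_-,T_+)$ of $w$: the leaves of $T_+$ with non-zero exponents are $i_1,\dots,i_n$, with exponents $r_1,\dots,r_n$; those of $T_-$ are $j_1,\dots,j_m$, with exponents $s_1,\dots,s_m$; and if the marked leaf is leaf number $\mu\geq 1$ from the left and the trees have $i+1$ carets, then $j=i+2-\mu$, while $c_i^j$ is absent if the leftmost leaf of $T_+$ is marked. Put $$D(w)=\sum_{k=1}^n r_k+\sum_{l=1}^m s_l+i_n+j_m+i,$$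 where $i_n$, $j_m$, $i$ count as $0$ if the corresponding part of the word is absent. Theorem. The set $\{x_0,x_1,c_1\}$ generates $T$; every $w\in T$ has exactly one reduced diagram, and its normal form represents $w$. Let $|w|$ be the word length of $w$ with respect to $\{x_0,x_1,c_1\}$. There is a constant $C>0$ such that for every $w\in T$ $$\frac{D(w)}C\le |w|,\qquad |w|\le C\,D(w)\ \text{ if } w\ne c_0,\qquad\text{and}\qquad \frac{N(w)}C\le |w|\le C\,N(w).$$ -/

import Mathlib

open Filter Topology

noncomputable section

namespace ThompsonT

/-! ### Thompson's group `T` -/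

/-- A dyadic rational number. -/
def IsDyadic (x : ℝ) : Prop := ∃ (a : ℤ) (n : ℕ), x = a / 2 ^ n

/-- `F` is the lift to the real line of an orientation-preserving dyadic piecewise-linear
homeomorphism of the circle `ℝ / ℤ`: it is an increasing bijection of `ℝ` commuting with the unit
translation, it maps the dyadic rationals onto the dyadic rationals, and away from a
finite set of dyadic points of `[0, 1)` (and their integer translates) it is locally affine with
slope an integer power of two. -/
structure IsThompsonLift (F : ℝ ≃o ℝ) : Prop where
  map_add_one : ∀ x, F (x + 1) = F x + 1
  dyadic_iff : ∀ x, IsDyadic (F x) ↔ IsDyadic x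
  pieces : ∃ B : Finset ℝ, (∀ b ∈ B, IsDyadic b) ∧
    ∀ x, Int.fract x ∉ B → ∃ m : ℤ, ∀ᶠ y in 𝓝 x, F y = F x + 2 ^ m * (y - x)

lemma IsDyadic.int (k : ℤ) : IsDyadic k := ⟨k, 0, by simp⟩

lemma IsDyadic.two_zpow (k : ℤ) : IsDyadic ((2 : ℝ) ^ k) := by
  rcases le_total 0 k with h | h
  · obtain ⟨n, rfl⟩ := Int.eq_ofNat_of_zero_le h
    exact ⟨2 ^ n, 0, by simp⟩
  · obtain ⟨n, hn⟩ := Int.eq_ofNat_of_zero_le (neg_nonneg.2 h)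
    refine ⟨1, n, ?_⟩
    rw [show k = -(n : ℤ) by omega, zpow_neg]
    simp

lemma IsDyadic.add {x y : ℝ} (hx : IsDyadic x) (hy : IsDyadic y) : IsDyadic (x + y) := by
  obtain ⟨a, m, rfl⟩ := hx
  obtain ⟨b, n, rfl⟩ := hy
  refine ⟨a * 2 ^ n + b * 2 ^ m, m + n, ?_⟩
  push_cast
  field_simp
  ring

lemma IsDyadic.mul {x y : ℝ} (hx : IsDyadic x) (hy : IsDyadic y) : IsDyadic (x * y) := by
  obtain ⟨a, m, rfl⟩ := hx
  obtain ⟨b, n, rfl⟩ := hy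
  refine ⟨a * b, m + n, ?_⟩
  push_cast
  field_simp
  try ring

lemma IsDyadic.neg {x : ℝ} (hx : IsDyadic x) : IsDyadic (-x) := by
  obtain ⟨a, m, rfl⟩ := hx
  exact ⟨-a, m, by push_cast; ring⟩

lemma IsDyadic.sub {x y : ℝ} (hx : IsDyadic x) (hy : IsDyadic y) : IsDyadic (x - y) := by
  rw [sub_eq_add_neg]; exact hx.add hy.neg

lemma IsDyadic.fract {x : ℝ} (hx : IsDyadic x) : IsDyadic (Int.fract x) := hx.sub (.int _)

lemma IsDyadic.affine_iff {x b : ℝ} (k : ℤ) (hb : IsDyadic b) :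
    IsDyadic ((2 : ℝ) ^ k * x + b) ↔ IsDyadic x := by
  refine ⟨fun h => ?_, fun h => ((IsDyadic.two_zpow k).mul h).add hb⟩
  have h2 := (IsDyadic.two_zpow (-k)).mul (h.sub hb)
  rwa [add_sub_cancel_right, ← mul_assoc, ← zpow_add₀ (by norm_num), neg_add_cancel, zpow_zero,
    one_mul] at h2

lemma map_add_int_of_map_add_one {F : ℝ → ℝ} (h : ∀ x, F (x + 1) = F x + 1) (x : ℝ) (k : ℤ) :
    F (x + k) = F x + k := by
  induction k using Int.induction_on generalizing x with
  | zero => simp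
  | succ n ih =>
    have := h (x + n)
    push_cast at *
    rw [← add_assoc, this, ih]; ring
  | pred n ih =>
    have := h (x + (-(n : ℝ) - 1))
    have h2 := ih x
    push_cast at *
    rw [show x + (-(n : ℝ) - 1) + 1 = x + -n by ring, h2] at this
    linarith

namespace IsThompsonLift

variable {F G : ℝ ≃o ℝ}

lemma map_add_int (hF : IsThompsonLift F) (x : ℝ) (k : ℤ) : F (x + k) = F x + k :=
  map_add_int_of_map_add_one (F := F) hF.map_add_one x k

lemma symm_add_one (h : ∀ x, F (x + 1) = F x + 1) (x : ℝ) : F.symm (x + 1) = F.symm x + 1 := by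
  apply F.injective
  rw [h]; simp

lemma one : IsThompsonLift (1 : ℝ ≃o ℝ) where
  map_add_one _ := rfl
  dyadic_iff _ := Iff.rfl
  pieces := ⟨∅, by simp, fun x _ => ⟨0, by simp⟩⟩

lemma inv (hF : IsThompsonLift F) : IsThompsonLift F⁻¹ where
  map_add_one := symm_add_one hF.map_add_one
  dyadic_iff x := by
    rw [← hF.dyadic_iff, show F (F⁻¹ x) = x from F.apply_symm_apply x]
  pieces := by
    classical
    obtain ⟨B, hB, hp⟩ := hF.pieces
    refine ⟨B.image fun b => Int.fract (F b), ?_, fun y hy => ?_⟩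
    · intro b hb
      obtain ⟨c, hc, rfl⟩ := Finset.mem_image.1 hb
      exact ((hF.dyadic_iff c).2 (hB c hc)).fract
    · change ∃ m : ℤ, ∀ᶠ u in 𝓝 y, F.symm u = F.symm y + 2 ^ m * (u - y)
      obtain ⟨m, hm⟩ := hp (F.symm y) fun hmem => hy <| Finset.mem_image.2 ⟨_, hmem, by
        rw [Int.fract.eq_1 (F.symm y), sub_eq_add_neg, ← Int.cast_neg, hF.map_add_int,
          F.apply_symm_apply, Int.fract_add_intCast]⟩
      refine ⟨-m, ?_⟩
      have ht : Tendsto F.symm (𝓝 y) (𝓝 (F.symm y)) := F.symm.continuous.tendsto y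
      filter_upwards [ht.eventually hm] with u hu
      rw [F.apply_symm_apply, F.apply_symm_apply] at hu
      have h2 : (2 : ℝ) ^ m ≠ 0 := by positivity
      have h3 : (2 : ℝ) ^ (-m) * 2 ^ m = 1 := by rw [zpow_neg, inv_mul_cancel₀ h2]
      linear_combination (-(2 : ℝ) ^ (-m)) * hu + (F.symm y - F.symm u) * h3

lemma mul (hF : IsThompsonLift F) (hG : IsThompsonLift G) : IsThompsonLift (F * G) where
  map_add_one x := by
    change F (G (x + 1)) = F (G x) + 1
    rw [hG.map_add_one, hF.map_add_one]
  dyadic_iff x := (hF.dyadic_iff _).trans (hG.dyadic_iff x)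
  pieces := by
    classical
    obtain ⟨B, hB, hp⟩ := hF.pieces
    obtain ⟨B', hB', hp'⟩ := hG.pieces
    refine ⟨B' ∪ B.image fun b => Int.fract (G.symm b), ?_, fun x hx => ?_⟩
    · intro b hb
      rcases Finset.mem_union.1 hb with hb | hb
      · exact hB' b hb
      · obtain ⟨c, hc, rfl⟩ := Finset.mem_image.1 hb
        exact ((hG.inv.dyadic_iff c).2 (hB c hc)).fract
    · rw [Finset.mem_union, not_or] at hx
      obtain ⟨m', hm'⟩ := hp' x hx.1
      obtain ⟨m, hm⟩ := hp (G x) fun hmem => hx.2 <| Finset.mem_image.2 ⟨_, hmem, by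
        have := hG.inv.map_add_int (G x) (-⌊G x⌋)
        change G.symm _ = G.symm _ + _ at this
        rw [Int.fract.eq_1 (G x), sub_eq_add_neg, ← Int.cast_neg, this, G.symm_apply_apply,
          Int.fract_add_intCast]⟩
      refine ⟨m + m', ?_⟩
      have ht : Tendsto G (𝓝 x) (𝓝 (G x)) := G.continuous.tendsto x
      filter_upwards [ht.eventually hm, hm'] with y h1 h2
      change F (G y) = F (G x) + _
      rw [h1, h2, zpow_add₀ (by norm_num)]
      ring

end IsThompsonLift

/-- Thompson's group `T`: the orientation-preserving homeomorphisms of the circle `ℝ / ℤ` that are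
piecewise linear with finitely many breakpoints, all of them dyadic, with slopes powers of two, and
that preserve the dyadic rationals. The product is composition of maps: `(v * u) t = v (u t)`. -/
def T : Subgroup (UnitAddCircle ≃ₜ UnitAddCircle) where
  carrier := {f | ∃ F : ℝ ≃o ℝ, IsThompsonLift F ∧ ∀ t : ℝ, f (t : UnitAddCircle) = (F t : ℝ)}
  one_mem' := ⟨1, .one, fun _ => rfl⟩
  mul_mem' := by
    rintro f g ⟨F, hF, hf⟩ ⟨G, hG, hg⟩
    refine ⟨F * G, hF.mul hG, fun t => ?_⟩
    change f (g t) = _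
    rw [hg, hf]; rfl
  inv_mem' := by
    rintro f ⟨F, hF, hf⟩
    refine ⟨F⁻¹, hF.inv, fun t => ?_⟩
    change f.symm t = _
    rw [Homeomorph.symm_apply_eq, hf]
    congr 1
    exact (F.apply_symm_apply t).symm

/-! ### The generators `x_n` and `c_n` -/

/-- The map of the circle induced by a bijection of the line commuting with the unit
translation. -/
def circleMap (F : ℝ ≃o ℝ) (h : ∀ x, F (x + 1) = F x + 1) : UnitAddCircle → UnitAddCircle :=
  Function.Periodic.lift (f := fun t : ℝ => ((F t : ℝ) : UnitAddCircle)) (c := 1) fun t => by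
    simp [h]

lemma circleMap_coe (F : ℝ ≃o ℝ) (h : ∀ x, F (x + 1) = F x + 1) (t : ℝ) :
    circleMap F h t = (F t : ℝ) := rfl

lemma continuous_circleMap (F : ℝ ≃o ℝ) (h : ∀ x, F (x + 1) = F x + 1) :
    Continuous (circleMap F h) := by
  refine (QuotientAddGroup.isQuotientMap_mk (N := AddSubgroup.zmultiples (1 : ℝ))).continuous_iff.2
    ?_
  exact continuous_quotient_mk'.comp F.continuous

/-- The element of `T` with a given lift. -/
def ofLift (F : ℝ ≃o ℝ) (hF : IsThompsonLift F) : T :=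
  ⟨{  toFun := circleMap F hF.map_add_one
      invFun := circleMap F.symm (IsThompsonLift.symm_add_one hF.map_add_one)
      left_inv := fun t => by
        induction t using QuotientAddGroup.induction_on with
        | H t => exact congrArg _ (F.symm_apply_apply t)
      right_inv := fun t => by
        induction t using QuotientAddGroup.induction_on with
        | H t => exact congrArg _ (F.apply_symm_apply t)
      continuous_toFun := continuous_circleMap _ _
      continuous_invFun := continuous_circleMap _ _ }, F, hF, fun _ => rfl⟩

/-- Data of a degree-one map on a fundamental domain: an increasing
continuous function, used on `[0, 1]` only, with `h 1 = h 0 + 1`. -/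
structure IsFundamental (h : ℝ → ℝ) : Prop where
  strictMono : StrictMono h
  continuous : Continuous h
  map_one : h 1 = h 0 + 1

/-- The extension of `h` from `[0, 1)` to `ℝ` that commutes with the unit translation. -/
def extend (h : ℝ → ℝ) (t : ℝ) : ℝ := ⌊t⌋ + h (Int.fract t)

namespace IsFundamental

variable {h : ℝ → ℝ}

lemma extend_add_one (t : ℝ) : extend h (t + 1) = extend h t + 1 := by
  simp [extend]; ring

lemma strictMono_extend (hh : IsFundamental h) : StrictMono (extend h) := by
  intro x y hxy
  unfold extend
  rcases (Int.floor_mono hxy.le).eq_or_lt with e | e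
  · have : Int.fract x < Int.fract y := by
      unfold Int.fract; rw [e]; linarith
    have := hh.strictMono this
    rw [e]; linarith
  · have h1 : h (Int.fract x) < h 0 + 1 := hh.map_one ▸ hh.strictMono (Int.fract_lt_one x)
    have h2 : h 0 ≤ h (Int.fract y) := hh.strictMono.monotone (Int.fract_nonneg y)
    have h3 : (⌊x⌋ : ℝ) + 1 ≤ ⌊y⌋ := by exact_mod_cast e
    linarith

lemma continuous_extend (hh : IsFundamental h) : Continuous (extend h) := by
  have h1 : Continuous ((fun s => h s - s) ∘ Int.fract) :=
    ContinuousOn.comp_fract'' (hh.continuous.sub continuous_id).continuousOn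
      (by simp [hh.map_one])
  have h2 : extend h = fun t => t + ((fun s => h s - s) ∘ Int.fract) t := by
    ext t
    simp only [extend, Function.comp]
    have := Int.floor_add_fract t
    linarith
  rw [h2]
  exact continuous_id.add h1

lemma surjective_extend (hh : IsFundamental h) : Function.Surjective (extend h) := by
  intro y
  have key := fun k : ℤ => map_add_int_of_map_add_one (F := extend h) extend_add_one 0 k
  obtain ⟨t, -, ht⟩ := intermediate_value_Icc (a := 0 + ((⌊y - extend h 0⌋ : ℤ) : ℝ))
    (b := 0 + ((⌊y - extend h 0⌋ + 1 : ℤ) : ℝ)) (by push_cast; linarith)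
    hh.continuous_extend.continuousOn (show y ∈ _ by
      rw [key, key]
      have h1 := Int.floor_le (y - extend h 0)
      have h2 := Int.lt_floor_add_one (y - extend h 0)
      push_cast
      constructor <;> linarith)
  exact ⟨t, ht⟩

/-- The increasing bijection of the line given by fundamental data. -/
def lift (hh : IsFundamental h) : ℝ ≃o ℝ :=
  hh.strictMono_extend.orderIsoOfSurjective _ hh.surjective_extend

lemma lift_apply (hh : IsFundamental h) (t : ℝ) : hh.lift t = extend h t := rfl

/-- A criterion: `h` is affine with slope a power of two and dyadic constant
term on each open interval cut out by finitely many dyadic points. -/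
lemma isThompsonLift (hh : IsFundamental h) (B : Finset ℝ) (hB : ∀ b ∈ B, IsDyadic b)
    (h0 : (0 : ℝ) ∈ B) (hd : ∀ b ∈ B, IsDyadic (h b))
    (hp : ∀ x, 0 < x → x < 1 → x ∉ B → ∃ (u v : ℝ) (m : ℤ) (b : ℝ), IsDyadic b ∧ u < x ∧ x < v ∧
      ∀ y, u < y → y < v → h y = 2 ^ m * y + b) : IsThompsonLift hh.lift where
  map_add_one := extend_add_one
  dyadic_iff x := by
    have e1 : IsDyadic (hh.lift x) ↔ IsDyadic (h (Int.fract x)) := by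
      rw [lift_apply, extend]
      refine ⟨fun H => ?_, fun H => (IsDyadic.int _).add H⟩
      simpa using H.sub (.int ⌊x⌋)
    have e2 : IsDyadic x ↔ IsDyadic (Int.fract x) := by
      refine ⟨fun H => H.fract, fun H => ?_⟩
      simpa using (IsDyadic.int ⌊x⌋).add H
    rw [e1, e2]
    by_cases hx : Int.fract x ∈ B
    · exact iff_of_true (hd _ hx) (hB _ hx)
    · have hpos : 0 < Int.fract x :=
        (Int.fract_nonneg x).lt_of_ne fun e => hx (e ▸ h0)
      obtain ⟨u, v, m, b, hb, hu, hv, he⟩ := hp _ hpos (Int.fract_lt_one x) hx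
      rw [he _ hu hv, IsDyadic.affine_iff m hb]
  pieces := by
    refine ⟨B, hB, fun x hx => ?_⟩
    have hpos : 0 < Int.fract x :=
      (Int.fract_nonneg x).lt_of_ne fun e => hx (e ▸ h0)
    have hlt := Int.fract_lt_one x
    obtain ⟨u, v, m, b, hb, hu, hv, he⟩ := hp _ hpos hlt hx
    refine ⟨m, ?_⟩
    have hfl := Int.floor_add_fract x
    have hev : ∀ᶠ y in 𝓝 x, y ∈ Set.Ioo (⌊x⌋ + max u 0 : ℝ) (⌊x⌋ + min v 1) := by
      refine Ioo_mem_nhds ?_ ?_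
      · have := max_lt hu hpos
        linarith
      · have := lt_min hv hlt
        linarith
    filter_upwards [hev] with y hy
    have h1 := le_max_left u 0
    have h2 := le_max_right u 0
    have h3 := min_le_left v 1
    have h4 := min_le_right v 1
    have hfy : ⌊y⌋ = ⌊x⌋ := by
      rw [Int.floor_eq_iff]
      constructor <;> linarith [hy.1, hy.2]
    have hfr : Int.fract y = y - ⌊x⌋ := by rw [Int.fract, hfy]
    rw [lift_apply, lift_apply, extend, extend, hfy, hfr, he _ hu hv,
      he _ (by linarith [hy.1]) (by linarith [hy.2])]
    rw [Int.fract]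
    ring

end IsFundamental

/-- The homeomorphism `x_n` on `[0, 1]`: with `d = 2⁻ⁿ`, it is the identity on `[0, 1 - d]`, and on
`[1 - d, 1 - d/2]`, `[1 - d/2, 1 - d/4]`, `[1 - d/4, 1]` it has slopes `1/2`, `1`, `2`. -/
def xFun (n : ℕ) (t : ℝ) : ℝ :=
  max (max (min t ((t + (1 - 1 / 2 ^ n)) / 2)) (t - 1 / 2 ^ n / 4)) (2 * t - 1)

/-- The homeomorphism `c_n` on `[0, 1]`, lifted to `ℝ`. The circle is cut at the points
`0, 1/2, 3/4, …, 1 - 1 / 2 ^ (n + 1)`, and `c_n` maps each of these `n + 2` intervals affinely onto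
the cyclically preceding one: with `d = 1 / 2 ^ (n + 1)`, it is `2 d t + 1 - d` on `[0, 1/2]`,
`2 t` on `[1/2, 1 - d]` and `t + 1 - d` on `[1 - d, 1]`. -/
def cFun (n : ℕ) (t : ℝ) : ℝ :=
  min (max (1 / 2 ^ n * t + 1 - 1 / 2 ^ (n + 1)) (2 * t)) (t + 1 - 1 / 2 ^ (n + 1))

lemma IsDyadic.one_div_two_pow (n : ℕ) : IsDyadic (1 / 2 ^ n) := ⟨1, n, by simp⟩

lemma isFundamental_xFun (n : ℕ) : IsFundamental (xFun n) where
  strictMono := by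
    intro x y hxy
    refine max_lt_max (max_lt_max (min_lt_min ?_ ?_) ?_) ?_ <;> linarith
  continuous := by unfold xFun; fun_prop
  map_one := by
    have h1 : (0 : ℝ) < 1 / 2 ^ n := by positivity
    have h2 : (1 : ℝ) / 2 ^ n ≤ 1 := by
      rw [div_le_one (by positivity)]; exact one_le_pow₀ (by norm_num)
    unfold xFun
    generalize (1 : ℝ) / 2 ^ n = d at *
    rw [max_eq_right (b := 2 * (1 : ℝ) - 1) (max_le ((min_le_left _ _).trans (by norm_num))
        (by linarith)),
      min_eq_left (a := (0 : ℝ)) (by linarith), max_eq_left (a := (0 : ℝ)) (by linarith),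
      max_eq_left (by norm_num)]
    norm_num

lemma isThompsonLift_xFun (n : ℕ) : IsThompsonLift (isFundamental_xFun n).lift := by
  have hdd := IsDyadic.one_div_two_pow n
  have h1 : (0 : ℝ) < 1 / 2 ^ n := by positivity
  have h2 : (1 : ℝ) / 2 ^ n ≤ 1 := by
    rw [div_le_one (by positivity)]; exact one_le_pow₀ (by norm_num)
  have e1 : ∀ t, t ≤ 1 - 1 / 2 ^ n → xFun n t = t := fun t ht => by
    unfold xFun
    generalize (1 : ℝ) / 2 ^ n = d at *
    have a1 : min t ((t + (1 - d)) / 2) = t := min_eq_left (by linarith)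
    have a2 : max t (t - d / 4) = t := max_eq_left (by linarith)
    rw [a1, a2, max_eq_left (by linarith)]
  have e2 : ∀ t, 1 - 1 / 2 ^ n ≤ t → t ≤ 1 - 1 / 2 ^ n / 2 →
      xFun n t = (t + (1 - 1 / 2 ^ n)) / 2 := fun t ht ht' => by
    unfold xFun
    generalize (1 : ℝ) / 2 ^ n = d at *
    have a1 : min t ((t + (1 - d)) / 2) = (t + (1 - d)) / 2 := min_eq_right (by linarith)
    have a2 : max ((t + (1 - d)) / 2) (t - d / 4) = (t + (1 - d)) / 2 :=
      max_eq_left (by linarith)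
    rw [a1, a2, max_eq_left (by linarith)]
  have e3 : ∀ t, 1 - 1 / 2 ^ n / 2 ≤ t → t ≤ 1 - 1 / 2 ^ n / 4 →
      xFun n t = t - 1 / 2 ^ n / 4 := fun t ht ht' => by
    unfold xFun
    generalize (1 : ℝ) / 2 ^ n = d at *
    have a1 : min t ((t + (1 - d)) / 2) = (t + (1 - d)) / 2 := min_eq_right (by linarith)
    have a2 : max ((t + (1 - d)) / 2) (t - d / 4) = t - d / 4 := max_eq_right (by linarith)
    rw [a1, a2, max_eq_left (by linarith)]
  have e4 : ∀ t, 1 - 1 / 2 ^ n / 4 ≤ t → xFun n t = 2 * t - 1 := fun t ht => by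
    unfold xFun
    generalize (1 : ℝ) / 2 ^ n = d at *
    rw [max_eq_right (max_le ((min_le_right _ _).trans (by linarith)) (by linarith))]
  generalize (1 : ℝ) / 2 ^ n = d at *
  have hone : IsDyadic 1 := by simpa using IsDyadic.int 1
  have hzero : IsDyadic 0 := by simpa using IsDyadic.int 0
  have hhalf : IsDyadic (2⁻¹) := by simpa using IsDyadic.two_zpow (-1)
  have hd2 : IsDyadic (d / 2) := by rw [div_eq_mul_inv]; exact hdd.mul hhalf
  have hd4 : IsDyadic (d / 4) := by
    rw [show d / 4 = d / 2 * 2⁻¹ by ring]; exact hd2.mul hhalf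
  have htwo : IsDyadic 2 := by simpa using IsDyadic.int 2
  classical
  refine (isFundamental_xFun n).isThompsonLift {0, 1 - d, 1 - d / 2, 1 - d / 4} ?_ (by simp) ?_ ?_
  · simp only [Finset.mem_insert, Finset.mem_singleton]
    rintro b (rfl | rfl | rfl | rfl)
    exacts [hzero, hone.sub hdd, hone.sub hd2, hone.sub hd4]
  · simp only [Finset.mem_insert, Finset.mem_singleton]
    rintro b (rfl | rfl | rfl | rfl)
    · rw [e1 _ (by linarith)]; exact hzero
    · rw [e1 _ (by linarith)]; exact hone.sub hdd
    · rw [e3 _ le_rfl (by linarith)]; exact (hone.sub hd2).sub hd4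
    · rw [e4 _ le_rfl]; exact (htwo.mul (hone.sub hd4)).sub hone
  · intro x hx0 hx1 hx
    simp only [Finset.mem_insert, Finset.mem_singleton, not_or] at hx
    obtain ⟨-, ha, hb, hc⟩ := hx
    rcases lt_or_gt_of_ne ha with ha | ha
    · exact ⟨-1, 1 - d, 0, 0, hzero, by linarith, ha, fun y _ hy => by
        rw [e1 _ hy.le]; simp⟩
    rcases lt_or_gt_of_ne hb with hb | hb
    · exact ⟨1 - d, 1 - d / 2, -1, (1 - d) * 2⁻¹, (hone.sub hdd).mul hhalf, ha, hb,
        fun y hy hy' => by rw [e2 _ hy.le hy'.le, zpow_neg_one]; ring⟩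
    rcases lt_or_gt_of_ne hc with hc | hc
    · exact ⟨1 - d / 2, 1 - d / 4, 0, -(d / 4), hd4.neg, hb, hc,
        fun y hy hy' => by rw [e3 _ hy.le hy'.le, zpow_zero]; ring⟩
    · exact ⟨1 - d / 4, 1, 1, -1, hone.neg, hc, hx1,
        fun y hy hy' => by rw [e4 _ hy.le, zpow_one]; ring⟩

lemma isFundamental_cFun (n : ℕ) : IsFundamental (cFun n) where
  strictMono := by
    have h1 : (0 : ℝ) < 1 / 2 ^ n := by positivity
    intro x y hxy
    refine min_lt_min (max_lt_max ?_ ?_) ?_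
    · have := mul_lt_mul_of_pos_left hxy h1
      linarith
    · linarith
    · linarith
  continuous := by unfold cFun; fun_prop
  map_one := by
    have h1 : (0 : ℝ) < 1 / 2 ^ (n + 1) := by positivity
    have h2 : (1 : ℝ) / 2 ^ (n + 1) ≤ 1 / 2 := by
      rw [pow_succ, one_div_le_one_div (by positivity) (by norm_num)]
      have : (1 : ℝ) ≤ 2 ^ n := one_le_pow₀ (by norm_num)
      linarith
    have h3 : (1 : ℝ) / 2 ^ n = 2 * (1 / 2 ^ (n + 1)) := by rw [pow_succ]; field_simp
    unfold cFun
    rw [h3]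
    generalize (1 : ℝ) / 2 ^ (n + 1) = d at *
    rw [max_eq_right (by linarith), min_eq_right (by linarith), max_eq_left (by linarith),
      min_eq_left (by linarith)]
    ring

lemma isThompsonLift_cFun (n : ℕ) : IsThompsonLift (isFundamental_cFun n).lift := by
  have hdd := IsDyadic.one_div_two_pow (n + 1)
  have h1 : (0 : ℝ) < 1 / 2 ^ (n + 1) := by positivity
  have h2 : (1 : ℝ) / 2 ^ (n + 1) ≤ 1 / 2 := by
    rw [pow_succ, one_div_le_one_div (by positivity) (by norm_num)]
    have : (1 : ℝ) ≤ 2 ^ n := one_le_pow₀ (by norm_num)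
    linarith
  have h3 : (1 : ℝ) / 2 ^ n = 2 * (1 / 2 ^ (n + 1)) := by rw [pow_succ]; field_simp
  have h4 : (2 : ℝ) ^ (-(n : ℤ)) = 2 * (1 / 2 ^ (n + 1)) := by
    rw [← h3, zpow_neg, zpow_natCast, one_div]
  have e1 : ∀ t, 0 ≤ t → t ≤ 1 / 2 →
      cFun n t = 2 * (1 / 2 ^ (n + 1)) * t + (1 - 1 / 2 ^ (n + 1)) := fun t h0 ht => by
    unfold cFun
    rw [h3]
    generalize (1 : ℝ) / 2 ^ (n + 1) = d at *
    have a1 : 0 ≤ (1 - d) * (1 - 2 * t) := mul_nonneg (by linarith) (by linarith)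
    have a2 : 0 ≤ (1 - 2 * d) * t := mul_nonneg (by linarith) (by linarith)
    have a3 : max (2 * d * t + 1 - d) (2 * t) = 2 * d * t + 1 - d := max_eq_left (by linarith)
    rw [a3, min_eq_left (by linarith)]
    ring
  have e2 : ∀ t, 1 / 2 ≤ t → t ≤ 1 - 1 / 2 ^ (n + 1) → cFun n t = 2 * t := fun t ht ht' => by
    unfold cFun
    rw [h3]
    generalize (1 : ℝ) / 2 ^ (n + 1) = d at *
    have a1 : 0 ≤ (1 - d) * (2 * t - 1) := mul_nonneg (by linarith) (by linarith)
    have a3 : max (2 * d * t + 1 - d) (2 * t) = 2 * t := max_eq_right (by linarith)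
    rw [a3, min_eq_left (by linarith)]
  have e3 : ∀ t, 1 - 1 / 2 ^ (n + 1) ≤ t → cFun n t = t + (1 - 1 / 2 ^ (n + 1)) :=
    fun t ht => by
    unfold cFun
    rw [h3]
    generalize (1 : ℝ) / 2 ^ (n + 1) = d at *
    have a1 : 0 ≤ (1 - d) * (2 * t - 1) := mul_nonneg (by linarith) (by linarith)
    have a3 : max (2 * d * t + 1 - d) (2 * t) = 2 * t := max_eq_right (by linarith)
    rw [a3, min_eq_right (by linarith)]
    ring
  generalize (1 : ℝ) / 2 ^ (n + 1) = d at *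
  have hone : IsDyadic 1 := by simpa using IsDyadic.int 1
  have hzero : IsDyadic 0 := by simpa using IsDyadic.int 0
  have hhalf : IsDyadic (1 / 2) := by simpa using IsDyadic.two_zpow (-1)
  have htwo : IsDyadic 2 := by simpa using IsDyadic.int 2
  classical
  refine (isFundamental_cFun n).isThompsonLift {0, 1 / 2, 1 - d} ?_ (by simp) ?_ ?_
  · simp only [Finset.mem_insert, Finset.mem_singleton]
    rintro b (rfl | rfl | rfl)
    exacts [hzero, hhalf, hone.sub hdd]
  · simp only [Finset.mem_insert, Finset.mem_singleton]
    rintro b (rfl | rfl | rfl)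
    · rw [e1 _ le_rfl (by norm_num), mul_zero, zero_add]; exact hone.sub hdd
    · rw [e2 _ le_rfl (by linarith)]; exact htwo.mul hhalf
    · rw [e3 _ le_rfl]; exact (hone.sub hdd).add (hone.sub hdd)
  · intro x hx0 hx1 hx
    simp only [Finset.mem_insert, Finset.mem_singleton, not_or] at hx
    obtain ⟨-, ha, hb⟩ := hx
    rcases lt_or_gt_of_ne ha with ha | ha
    · exact ⟨0, 1 / 2, -(n : ℤ), 1 - d, hone.sub hdd, hx0, ha, fun y hy hy' => by
        rw [e1 _ hy.le hy'.le, h4]⟩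
    rcases lt_or_gt_of_ne hb with hb | hb
    · exact ⟨1 / 2, 1 - d, 1, 0, hzero, ha, hb, fun y hy hy' => by
        rw [e2 _ hy.le hy'.le, zpow_one, add_zero]⟩
    · exact ⟨1 - d, 1, 0, 1 - d, hone.sub hdd, hb, hx1, fun y hy hy' => by
        rw [e3 _ hy.le, zpow_zero, one_mul]⟩

/-- The generator `x_n` of `T`, for `n ≥ 0`. -/
def x (n : ℕ) : T := ofLift (isFundamental_xFun n).lift (isThompsonLift_xFun n)

/-- The generator `c_n` of `T`, for `n ≥ 0`; it has order `n + 2`. -/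
def c (n : ℕ) : T := ofLift (isFundamental_cFun n).lift (isThompsonLift_cFun n)

/-! ### Marked tree pair diagrams -/

/-- Finite rooted binary trees: inner nodes are the carets, `nil` is a leaf. The leaves
are numbered from left to right starting with `0`. -/
abbrev BTree := BinaryTree Unit

/-- The leaf intervals `[a, a + w]` of the subdivision of `[a₀, a₀ + w₀]` described by a tree, as
pairs `(a, w)`, from left to right; a caret halves the interval of its node. -/
def leafIntervals : BTree → ℝ → ℝ → List (ℝ × ℝ)
  | .nil, a, w => [(a, w)]
  | .node _ l r, a, w => leafIntervals l a (w / 2) ++ leafIntervals r (a + w / 2) (w / 2)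

/-- The interval `(a, w)` of the leaf number `k` of the tree `t` subdividing `[0, 1]`. -/
def leafInterval (t : BTree) (k : ℕ) : ℝ × ℝ := (leafIntervals t 0 1).getD k (0, 0)

/-- The numbers of the left leaves of the exposed carets (the carets both of whose
children are leaves). -/
def exposed : BTree → Set ℕ
  | .nil => ∅
  | .node _ .nil .nil => {0}
  | .node _ l r => exposed l ∪ (fun k => l.numLeaves + k) '' exposed r

/-- A marked tree pair diagram: two trees with the same number of leaves and a mark on one leaf of
the target tree. -/
@[ext]
structure TreePair where
  source : BTree
  target : BTree
  numLeaves_eq : source.numLeaves = target.numLeaves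
  mark : ℕ
  mark_lt : mark < target.numLeaves

namespace TreePair

/-- The number of leaves of either tree. -/
def leaves (d : TreePair) : ℕ := d.target.numLeaves

/-- The number of carets of either tree. -/
def carets (d : TreePair) : ℕ := d.target.numNodes

/-- The number of the leaf of the target tree that is paired with the leaf `k` of the source tree:
counting starts at the marked leaf and wraps around. -/
def pairing (d : TreePair) (k : ℕ) : ℕ := (d.mark + k) % d.leaves

/-- The diagram represents `w`: each leaf interval of the source tree is mapped by `w` affinely and
preserving the orientation onto the paired leaf interval of the target tree. -/
def Represents (d : TreePair) (w : T) : Prop :=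
  ∀ k < d.leaves, ∀ t : ℝ, 0 ≤ t → t ≤ 1 →
    w.1 (((leafInterval d.source k).1 + t * (leafInterval d.source k).2 : ℝ) : UnitAddCircle) =
      (((leafInterval d.target (d.pairing k)).1 + t * (leafInterval d.target (d.pairing k)).2 : ℝ) :
        UnitAddCircle)

/-- The diagram is reduced: no exposed caret of the source tree is paired with an
exposed caret of the target tree. -/
def IsReduced (d : TreePair) : Prop :=
  ∀ k ∈ exposed d.source, d.pairing k ∉ exposed d.target

/-- `d` is a reduced tree pair diagram of `w`. -/
def IsReducedDiagramOf (d : TreePair) (w : T) : Prop := d.IsReduced ∧ d.Represents w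

end TreePair

/-! ### Normal forms -/

/-- Leaf exponents of a subtree off the right side of the whole tree, when `e` left edges,
none of which reaches the right side, lead consecutively up from the root of the subtree. -/
def leafExponentsAux : BTree → ℕ → List ℕ
  | .nil, e => [e]
  | .node _ l r, e => leafExponentsAux l (e + 1) ++ leafExponentsAux r 0

/-- The leaf exponents of a tree from left to right: the exponent of a leaf is the
length of the longest path of left edges going up from it and not reaching the right side of
the tree, which consists of the root and everything joined to it by right edges. -/
def leafExponents : BTree → List ℕ
  | .nil => [0]
  | .node _ l r => leafExponentsAux l 0 ++ leafExponents r

/-- A word `x_{i_1}^{r_1} ⋯ x_{i_n}^{r_n} c_i^j x_{j_m}^{-s_m} ⋯ x_{j_1}^{-s_1}` with `i_1 < ⋯ < i_n`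
and `j_1 < ⋯ < j_m`: `pos` and `neg` map each index to its exponent (zero for the
generators that do not occur), and `mid` is `(i, j)`, or `none` when there is no factor `c_i^j`. -/
structure PCQWord where
  pos : ℕ →₀ ℕ
  mid : Option (ℕ × ℕ)
  neg : ℕ →₀ ℕ

/-- The positive element `x_{i_1}^{r_1} ⋯ x_{i_n}^{r_n}`, with increasing indices. -/
def positiveElement (r : ℕ →₀ ℕ) : T :=
  ((r.support.sort (· ≤ ·)).map fun i => x i ^ r i).prod

namespace PCQWord

/-- The element of `T` that the word represents. -/
def eval (v : PCQWord) : T :=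
  positiveElement v.pos * (v.mid.elim 1 fun ij => c ij.1 ^ ij.2) * (positiveElement v.neg)⁻¹

/-- `∑ r_k + ∑ s_l + i_n + j_m + i`; a missing `i_n`, `j_m` or `i` counts as zero. -/
def weight (v : PCQWord) : ℕ :=
  (v.pos.sum fun _ r => r) + (v.neg.sum fun _ s => s) + v.pos.support.sup id +
    v.neg.support.sup id + v.mid.elim 0 Prod.fst

end PCQWord

/-- The `pcq` factorization associated to a marked tree pair diagram. If the trees have `i + 1`
carets, so `i + 2` leaves, the middle part is the power of `c_i` (the map sending every leaf of the
all-right tree to the preceding one cyclically) that sends the leaf `0` to the marked leaf; it is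
absent when the leaf `0` of the target tree is marked. -/
def TreePair.pcq (d : TreePair) : PCQWord where
  pos := (leafExponents d.target).toFinsupp
  mid := if d.mark = 0 then none else some (d.leaves - 2, d.leaves - d.mark)
  neg := (leafExponents d.source).toFinsupp

open Classical in
/-- The reduced tree pair diagram of an element of `T`; the second branch, which serves only to make
the definition total, is the trivial diagram. -/
def reducedDiagram (w : T) : TreePair :=
  if h : ∃ d : TreePair, d.IsReducedDiagramOf w then h.choose else ⟨.nil, .nil, rfl, 0, by simp⟩

/-- `N(w)`: the number of carets in the reduced diagram. -/
def N (w : T) : ℕ := (reducedDiagram w).carets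

/-- The normal form: the `pcq` factorization associated to the reduced diagram. -/
def normalForm (w : T) : PCQWord := (reducedDiagram w).pcq

/-- `D(w)`: the sum of the exponents of the normal form plus `i_n + j_m + i`. -/
def D (w : T) : ℕ := (normalForm w).weight

/-- The word length of `g` with respect to a set `S` of generators and their inverses. -/
def wordLength {G : Type*} [Group G] (S : Set G) (g : G) : ℕ :=
  sInf {n | ∃ l : List G, l.length = n ∧ (∀ a ∈ l, a ∈ S ∨ a⁻¹ ∈ S) ∧ l.prod = g}

/-- The finite generating set `{x_0, x_1, c_1}`. -/
def generators : Set T := {x 0, x 1, c 1}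

end ThompsonT

end

noncomputable section

namespace ThompsonT

/-! ### Addresses of standard dyadic intervals -/

/-! Call an address good for `w` if `w` maps its interval affinely onto a standard dyadic interval
(`Maps`), and bad otherwise. Bad addresses are closed under prefixes and finite in number
(`exists_level`), so they are the inner nodes of a tree `badTree w`. Its leaves, the maximal good
intervals, are carried bijectively and in cyclic order onto the leaves of `badTree w⁻¹`, which gives
a reduced diagram. Conversely the source of any diagram of `w` has all bad addresses as nodes, and a
reduced one has no other nodes: below a good node some exposed caret would be carried to an exposed
caret. So the reduced diagram is unique and `N w` counts the bad addresses (`N_eq_card`).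

An address bad for `u * w` is bad for `w`, or `w` carries it to an address bad for `u`. Thus `N` is
subadditive (`N_mul_le`), and it is at most a constant times the word length.

The element `x n` joins two neighbouring subtrees hanging from the right side of a tree (`rep_x`).
Hence the positive word given by the leaf exponents of a tree carries the all-right tree to that
tree (`rep_leafExponents`), while powers of `c n` rotate the leaves of the all-right tree. The
normal form therefore has the diagram from which it was read off, and a diagram determines its
element (`Rep.unique`).

For the upper bounds, conjugation by `x 0` shifts the indices of the `x k` with `k ≥ 1`, so positive
words telescope to a length linear in the exponent sum and the largest index
(`hasWord_positiveElement`). A nontrivial rotation by a power of `c i` regroups the leaves into two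
blocks, exchanges these by `c 0` and ungroups them, with at most `3 * i + 2` letters
(`hasWord_of_rep_allRight`). This is at most `5 * i` unless `i = 0`, which happens only for `c 0`;
hence the exception for `D`. Finally `D w ≤ 5 * N w`, and `c 0` needs no exception for `N` because
`N (c 0) > 0`. -/

/-- The affine parametrization by `[0, 1]` of the standard dyadic interval whose address is a list
of bits, `false` for a left half and `true` for a right half. -/
def pt : List Bool → ℝ → ℝ
  | [], t => t
  | false :: p, t => pt p t / 2
  | true :: p, t => (1 + pt p t) / 2

lemma pt_eq (p : List Bool) (t : ℝ) : pt p t = pt p 0 + t * (1 / 2) ^ p.length := by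
  induction p with
  | nil => simp [pt]
  | cons b p ih => cases b <;> simp only [pt, List.length_cons, pow_succ] <;> linarith

lemma pt_append (p q : List Bool) (t : ℝ) : pt (p ++ q) t = pt p (pt q t) := by
  induction p with
  | nil => rfl
  | cons b p ih => cases b <;> simp [pt, ih]

lemma pt_strictMono (p : List Bool) : StrictMono (pt p) := by
  intro a b h
  rw [pt_eq p a, pt_eq p b]
  have : (0 : ℝ) < (1 / 2) ^ p.length := by positivity
  gcongr

lemma pt_zero_nonneg (p : List Bool) : 0 ≤ pt p 0 := by
  induction p with
  | nil => simp [pt]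
  | cons b p ih => cases b <;> simp only [pt] <;> linarith

lemma pt_one_le (p : List Bool) : pt p 1 ≤ 1 := by
  induction p with
  | nil => simp [pt]
  | cons b p ih => cases b <;> simp only [pt] <;> linarith

lemma pt_nonneg (p : List Bool) {t : ℝ} (h : 0 ≤ t) : 0 ≤ pt p t :=
  (pt_zero_nonneg p).trans ((pt_strictMono p).monotone h)

lemma pt_le_one (p : List Bool) {t : ℝ} (h : t ≤ 1) : pt p t ≤ 1 :=
  ((pt_strictMono p).monotone h).trans (pt_one_le p)

lemma pt_lt_one (p : List Bool) {t : ℝ} (h : t < 1) : pt p t < 1 :=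
  (pt_strictMono p h).trans_le (pt_one_le p)

/-- The midpoint is compared instead of the right endpoint because its value stays below `1`, so the
hypotheses can be obtained from equalities on the circle. -/
lemma pt_injective {p q : List Bool} (h0 : pt p 0 = pt q 0) (h1 : pt p (1 / 2) = pt q (1 / 2)) :
    p = q := by
  have hlt (r : List Bool) : pt r (1 / 2) < 1 := pt_lt_one r (by norm_num)
  have hlt' (r : List Bool) : pt r 0 < 1 := pt_lt_one r (by norm_num)
  have hnn := pt_zero_nonneg
  have hpos (r : List Bool) : 0 < pt r (1 / 2) :=
    (hnn r).trans_lt (pt_strictMono r (by norm_num))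
  induction p generalizing q with
  | nil =>
    match q with
    | [] => rfl
    | false :: q => simp only [pt] at h0 h1; linarith [hlt q]
    | true :: q => simp only [pt] at h0 h1; linarith [hnn q]
  | cons b p ih =>
    match b, q with
    | false, [] => simp only [pt] at h0 h1; linarith [hlt p]
    | true, [] => simp only [pt] at h0 h1; linarith [hnn p]
    | false, false :: q =>
      simp only [pt] at h0 h1
      rw [ih (q := q) (by linarith) (by linarith)]
    | true, true :: q =>
      simp only [pt] at h0 h1
      rw [ih (q := q) (by linarith) (by linarith)]
    | false, true :: q => simp only [pt] at h0 h1; linarith [hlt' p, hnn q]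
    | true, false :: q => simp only [pt] at h0 h1; linarith [hlt' q, hnn p]

lemma coe_circle_injOn {a b : ℝ} (ha : 0 ≤ a) (ha' : a < 1) (hb : 0 ≤ b) (hb' : b < 1)
    (h : (a : UnitAddCircle) = b) : a = b := by
  have hp : Fact ((0 : ℝ) < 1) := ⟨one_pos⟩
  exact (AddCircle.coe_eq_coe_iff_of_mem_Ico (p := (1 : ℝ)) (a := 0)
    ⟨ha, by simpa using ha'⟩ ⟨hb, by simpa using hb'⟩).1 h

/-- `w` maps the standard dyadic interval with address `p` affinely, preserving the orientation,
onto the one with address `q`. -/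
def Maps (w : T) (p q : List Bool) : Prop :=
  ∀ t : ℝ, 0 ≤ t → t ≤ 1 → w.1 (pt p t : UnitAddCircle) = (pt q t : ℝ)

namespace Maps

variable {u w : T} {p q r : List Bool}

lemma append (h : Maps w p q) (r : List Bool) : Maps w (p ++ r) (q ++ r) := by
  intro t h0 h1
  rw [pt_append, pt_append]
  exact h _ (pt_nonneg r h0) (pt_le_one r h1)

lemma mul (hu : Maps u q r) (hw : Maps w p q) : Maps (u * w) p r := by
  intro t h0 h1
  change u.1 (w.1 _) = _
  rw [hw t h0 h1, hu t h0 h1]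

lemma inv (hw : Maps w p q) : Maps w⁻¹ q p := by
  intro t h0 h1
  change w.1.symm _ = _
  rw [Homeomorph.symm_apply_eq, hw t h0 h1]

lemma one (p : List Bool) : Maps 1 p p := fun _ _ _ => rfl

lemma right_unique {q' : List Bool} (h : Maps w p q) (h' : Maps w p q') : q = q' := by
  have key (t : ℝ) (h0 : 0 ≤ t) (h1 : t < 1) : pt q t = pt q' t :=
    coe_circle_injOn (pt_nonneg _ h0) (pt_lt_one _ h1) (pt_nonneg _ h0) (pt_lt_one _ h1)
      ((h t h0 h1.le).symm.trans (h' t h0 h1.le))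
  exact pt_injective (key _ le_rfl (by norm_num)) (key _ (by norm_num) (by norm_num))

lemma left_unique {p' : List Bool} (h : Maps w p q) (h' : Maps w p' q) : p = p' :=
  h.inv.right_unique h'.inv

/-- This undoes one reduction: a pair of matching exposed carets can be merged, so their parent is
already good. -/
lemma of_halves (h0 : Maps w (p ++ [false]) (q ++ [false]))
    (h1 : Maps w (p ++ [true]) (q ++ [true])) : Maps w p q := by
  intro t ht ht'
  rcases le_total t (1 / 2) with h | h
  · have := h0 (2 * t) (by linarith) (by linarith)
    simpa [pt_append, pt] using this
  · have := h1 (2 * t - 1) (by linarith) (by linarith)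
    simpa [pt_append, pt] using this

end Maps

/-! ### Leaves and nodes of a tree -/

/-- The addresses of the leaves, from left to right. -/
def leafAddrs : BTree → List (List Bool)
  | .nil => [[]]
  | .node _ l r => (leafAddrs l).map (false :: ·) ++ (leafAddrs r).map (true :: ·)

/-- The addresses of the inner nodes. -/
def nodeAddrs : BTree → Finset (List Bool)
  | .nil => ∅
  | .node _ l r => insert [] ((nodeAddrs l).image (false :: ·) ∪ (nodeAddrs r).image (true :: ·))

@[simp] lemma length_leafAddrs (t : BTree) : (leafAddrs t).length = t.numLeaves := by
  induction t with
  | nil => rfl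
  | node _ l r hl hr => simp [leafAddrs, BinaryTree.numLeaves, hl, hr]

lemma card_nodeAddrs (t : BTree) : (nodeAddrs t).card = t.numNodes := by
  induction t with
  | nil => rfl
  | node _ l r hl hr =>
    have hi (b : Bool) : Function.Injective (b :: · : List Bool → List Bool) :=
      List.cons_injective
    rw [nodeAddrs, Finset.card_insert_of_notMem (by simp), Finset.card_union_of_disjoint,
      Finset.card_image_of_injective _ (hi _), Finset.card_image_of_injective _ (hi _), hl, hr]
    · rfl
    · simp [Finset.disjoint_left]

lemma leafIntervals_eq (t : BTree) (a h : ℝ) :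
    leafIntervals t a h =
      (leafAddrs t).map fun p => (a + h * pt p 0, h * (1 / 2 : ℝ) ^ p.length) := by
  induction t generalizing a h with
  | nil => simp [leafIntervals, leafAddrs, pt]
  | node _ l r hl hr =>
    simp only [leafIntervals, leafAddrs, hl, hr, List.map_append, List.map_map]
    congr 1 <;> refine List.map_congr_left fun p _ => ?_ <;>
      simp only [Function.comp, pt, List.length_cons, Prod.mk.injEq] <;> constructor <;> ring

lemma leafInterval_point (t : BTree) {k : ℕ} (hk : k < (leafAddrs t).length) (s : ℝ) :
    (leafInterval t k).1 + s * (leafInterval t k).2 = pt (leafAddrs t)[k] s := by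
  rw [leafInterval, leafIntervals_eq, List.getD_eq_getElem _ _ (by simpa using hk),
    List.getElem_map, pt_eq _ s]
  simp

lemma leafAddrs_ne_nil (t : BTree) : leafAddrs t ≠ [] := by
  rw [← List.length_pos_iff, length_leafAddrs]
  exact t.numLeaves_pos

/-- Leaf intervals do not overlap, so a left endpoint identifies its leaf. This recognizes the next
leaf in `exists_rep_of_maps`. -/
lemma eq_of_mem_leafAddrs {t : BTree} {p q : List Bool} (hp : p ∈ leafAddrs t)
    (hq : q ∈ leafAddrs t) (h : pt p 0 = pt q 0) : p = q := by
  induction t generalizing p q with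
  | nil => simp_all [leafAddrs]
  | node _ l r hl hr =>
    simp only [leafAddrs, List.mem_append, List.mem_map] at hp hq
    have hlt (r : List Bool) : pt r 0 < 1 := pt_lt_one r (by norm_num)
    obtain ⟨p, hp, rfl⟩ | ⟨p, hp, rfl⟩ := hp <;> obtain ⟨q, hq, rfl⟩ | ⟨q, hq, rfl⟩ := hq <;>
      simp only [pt] at h
    · rw [hl hp hq (by linarith)]
    · linarith [hlt p, pt_zero_nonneg q]
    · linarith [hlt q, pt_zero_nonneg p]
    · rw [hr hp hq (by linarith)]

lemma nodup_leafAddrs (t : BTree) : (leafAddrs t).Nodup := by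
  induction t with
  | nil => simp [leafAddrs]
  | node _ l r hl hr =>
    rw [leafAddrs, List.nodup_append]
    refine ⟨hl.map List.cons_injective, hr.map List.cons_injective, ?_⟩
    simp

lemma exists_leafAddrs_point (t : BTree) {y : ℝ} (h0 : 0 ≤ y) (h1 : y ≤ 1) :
    ∃ p ∈ leafAddrs t, ∃ s, 0 ≤ s ∧ s ≤ 1 ∧ y = pt p s := by
  induction t generalizing y with
  | nil => exact ⟨[], by simp [leafAddrs], y, h0, h1, rfl⟩
  | node _ l r hl hr =>
    rcases le_total y (1 / 2) with h | h
    · obtain ⟨p, hp, s, hs, hs', e⟩ := hl (y := 2 * y) (by linarith) (by linarith)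
      exact ⟨false :: p, by simp [leafAddrs, hp], s, hs, hs', by simp only [pt]; linarith⟩
    · obtain ⟨p, hp, s, hs, hs', e⟩ := hr (y := 2 * y - 1) (by linarith) (by linarith)
      exact ⟨true :: p, by simp [leafAddrs, hp], s, hs, hs', by simp only [pt]; linarith⟩

/-- The three claims need one another: at a caret, the two lists fit together because the left one
ends, and the right one starts, at the midpoint. -/
lemma leafAddrs_chain (t : BTree) :
    (leafAddrs t).IsChain (fun p q => pt p 1 = pt q 0) ∧
      (∀ p ∈ (leafAddrs t).head?, pt p 0 = 0) ∧ ∀ p ∈ (leafAddrs t).getLast?, pt p 1 = 1 := by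
  induction t with
  | nil => simp [leafAddrs, pt]
  | node _ l r hl hr =>
    obtain ⟨p, hp⟩ := Option.ne_none_iff_exists'.1
      (mt List.head?_eq_none_iff.1 (leafAddrs_ne_nil l))
    obtain ⟨q, hq⟩ := Option.ne_none_iff_exists'.1
      (mt List.head?_eq_none_iff.1 (leafAddrs_ne_nil r))
    obtain ⟨p', hp'⟩ := Option.ne_none_iff_exists'.1
      (mt List.getLast?_eq_none_iff.1 (leafAddrs_ne_nil l))
    obtain ⟨q', hq'⟩ := Option.ne_none_iff_exists'.1
      (mt List.getLast?_eq_none_iff.1 (leafAddrs_ne_nil r))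
    obtain ⟨hl1, hl2, hl3⟩ := hl
    obtain ⟨hr1, hr2, hr3⟩ := hr
    refine ⟨?_, ?_, ?_⟩
    · rw [leafAddrs, List.isChain_append]
      refine ⟨?_, ?_, ?_⟩
      · rw [List.isChain_map]
        exact hl1.imp fun a b h => by simp only [pt]; rw [h]
      · rw [List.isChain_map]
        exact hr1.imp fun a b h => by simp only [pt]; rw [h]
      · simp [hp', hq, pt, hl3 p' hp', hr2 q hq]
    · simp [leafAddrs, hp, pt, hl2 p hp]
    · simp [leafAddrs, hq', pt, hr3 q' hq']

/-- Consecutive leaves, in the cyclic order, have a common endpoint. -/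
lemma leafAddrs_cyclic_succ (t : BTree) {k : ℕ} (hk : k < (leafAddrs t).length) :
    ((pt (leafAddrs t)[k] 1 : ℝ) : UnitAddCircle) =
      (pt ((leafAddrs t)[(k + 1) % (leafAddrs t).length]'(Nat.mod_lt _ (by omega))) 0 : ℝ) := by
  obtain ⟨h1, h2, h3⟩ := leafAddrs_chain t
  rcases Nat.lt_or_ge (k + 1) (leafAddrs t).length with h | h
  · simp only [Nat.mod_eq_of_lt h]
    rw [List.isChain_iff_getElem.1 h1 k h]
  · have e : k + 1 = (leafAddrs t).length := by omega
    simp only [e, Nat.mod_self]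
    rw [h2 _ (by simp [List.head?_eq_getElem?]),
      h3 _ (by simp [List.getLast?_eq_getElem?, ← e])]
    simp

/-- The nodes are the proper prefixes of the leaves. -/
lemma mem_nodeAddrs_iff {t : BTree} {p : List Bool} :
    p ∈ nodeAddrs t ↔ ∃ b q, p ++ b :: q ∈ leafAddrs t := by
  induction t generalizing p with
  | nil => simp [nodeAddrs, leafAddrs]
  | node _ l r hl hr =>
    match p with
    | [] =>
      obtain ⟨p, hp⟩ := List.exists_mem_of_ne_nil _ (leafAddrs_ne_nil l)
      simp only [nodeAddrs, Finset.mem_insert_self, true_iff]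
      exact ⟨false, p, by simp [leafAddrs, hp]⟩
    | false :: p => simp [nodeAddrs, leafAddrs, hl]
    | true :: p => simp [nodeAddrs, leafAddrs, hr]

lemma exists_leaf_prefix {t : BTree} {p : List Bool} (hp : p ∉ nodeAddrs t) :
    ∃ q ∈ leafAddrs t, ∃ r, p = q ++ r := by
  induction t generalizing p with
  | nil => exact ⟨[], by simp [leafAddrs], p, rfl⟩
  | node _ l r hl hr =>
    match p with
    | [] => simp [nodeAddrs] at hp
    | false :: p =>
      obtain ⟨q, hq, s, rfl⟩ := hl (p := p) (by simpa [nodeAddrs] using hp)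
      exact ⟨false :: q, by simp [leafAddrs, hq], s, rfl⟩
    | true :: p =>
      obtain ⟨q, hq, s, rfl⟩ := hr (p := p) (by simpa [nodeAddrs] using hp)
      exact ⟨true :: q, by simp [leafAddrs, hq], s, rfl⟩

lemma notMem_nodeAddrs_of_leaf {t : BTree} {p : List Bool} (hp : p ∈ leafAddrs t) :
    p ∉ nodeAddrs t := by
  induction t generalizing p with
  | nil => simp [nodeAddrs]
  | node _ l r hl hr =>
    simp only [leafAddrs, List.mem_append, List.mem_map] at hp
    obtain ⟨p, hp, rfl⟩ | ⟨p, hp, rfl⟩ := hp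
    · simpa [nodeAddrs] using hl hp
    · simpa [nodeAddrs] using hr hp

/-- Trees can thus be compared as sets of addresses, which is how uniqueness of both trees of a
diagram is proved. -/
lemma nodeAddrs_injective : Function.Injective nodeAddrs := by
  intro s
  induction s with
  | nil =>
    rintro (_ | ⟨_, l, r⟩) h
    · rfl
    · have : ([] : List Bool) ∈ nodeAddrs (.node () l r) := by simp [nodeAddrs]
      rw [← h] at this
      simp [nodeAddrs] at this
  | node _ l r hl hr =>
    rintro (_ | ⟨_, l', r'⟩) h
    · have : ([] : List Bool) ∈ nodeAddrs (.node () l r) := by simp [nodeAddrs]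
      rw [h] at this
      simp [nodeAddrs] at this
    · rw [@hl l', @hr r']
      · ext p
        simpa [nodeAddrs] using Finset.ext_iff.1 h (true :: p)
      · ext p
        simpa [nodeAddrs] using Finset.ext_iff.1 h (false :: p)

/-- A prefix-closed set of addresses of bounded length is the set of nodes of a tree. -/
lemma exists_tree_of_prefix_closed {P : List Bool → Prop} (hP : ∀ p q, P (p ++ q) → P p) {L : ℕ}
    (hL : ∀ p, L ≤ p.length → ¬ P p) : ∃ t, ∀ p, p ∈ nodeAddrs t ↔ P p := by
  induction L generalizing P with
  | zero => exact ⟨.nil, fun p => by simpa [nodeAddrs] using hL p⟩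
  | succ L ih =>
    by_cases h : P []
    · have key (b : Bool) : ∃ t, ∀ p, p ∈ nodeAddrs t ↔ P (b :: p) :=
        ih (P := fun p => P (b :: p)) (fun p q => hP (b :: p) q)
          fun p hp => hL _ (by simpa using hp)
      obtain ⟨l, hl⟩ := key false
      obtain ⟨r, hr⟩ := key true
      refine ⟨.node () l r, fun p => ?_⟩
      match p with
      | [] => simpa [nodeAddrs] using h
      | false :: p => simpa [nodeAddrs] using hl p
      | true :: p => simpa [nodeAddrs] using hr p
    · exact ⟨.nil, fun p => by simpa [nodeAddrs] using fun hp => h (hP [] p hp)⟩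

/-! ### Exposed carets -/

/-- Together with `exposed_of_mem` this translates leaf numbers of exposed carets into pairs of
sibling leaf addresses. -/
lemma getElem?_of_exposed {t : BTree} {k : ℕ} (h : k ∈ exposed t) :
    ∃ p, (leafAddrs t)[k]? = some (p ++ [false]) ∧ (leafAddrs t)[k + 1]? = some (p ++ [true]) := by
  induction t generalizing k with
  | nil => simp [exposed] at h
  | node _ l r hl hr =>
    by_cases hn : l = .nil ∧ r = .nil
    · obtain ⟨rfl, rfl⟩ := hn
      simp only [exposed, Set.mem_singleton_iff] at h
      subst h
      exact ⟨[], by simp [leafAddrs]⟩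
    · have e : exposed (.node () l r) = exposed l ∪ (fun k => l.numLeaves + k) '' exposed r := by
        rcases l with _ | _ <;> rcases r with _ | _ <;> first | rfl | simp at hn
      change k ∈ exposed (.node () l r) at h
      rw [e] at h
      rcases h with h | ⟨k, h, rfl⟩
      · obtain ⟨p, h0, h1⟩ := hl h
        have a0 := (List.getElem?_eq_some_iff.1 h0).1
        have a1 := (List.getElem?_eq_some_iff.1 h1).1
        refine ⟨false :: p, ?_, ?_⟩
        · rw [leafAddrs, List.getElem?_append_left (by simpa using a0)]
          simp [h0]
        · rw [leafAddrs, List.getElem?_append_left (by simpa using a1)]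
          simp [h1]
      · obtain ⟨p, h0, h1⟩ := hr h
        refine ⟨true :: p, ?_, ?_⟩
        · rw [leafAddrs, List.getElem?_append_right (by simp)]
          simp [h0]
        · rw [leafAddrs, List.getElem?_append_right (by simp; omega)]
          simp [add_assoc, h1]

lemma nil_of_nil_mem_leafAddrs {t : BTree} (h : [] ∈ leafAddrs t) : t = .nil := by
  cases t with
  | nil => rfl
  | node => simp [leafAddrs] at h

lemma exposed_of_mem {t : BTree} {k : ℕ} {p : List Bool}
    (h0 : (leafAddrs t)[k]? = some (p ++ [false])) (h1 : p ++ [true] ∈ leafAddrs t) :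
    k ∈ exposed t := by
  induction t generalizing k p with
  | nil => simp [leafAddrs] at h1
  | node _ l r hl hr =>
    change k ∈ exposed (.node () l r)
    by_cases hn : l = .nil ∧ r = .nil
    · obtain ⟨rfl, rfl⟩ := hn
      obtain ⟨hk, h0⟩ := List.getElem?_eq_some_iff.1 h0
      simp only [leafAddrs, List.map_cons, List.map_nil, List.cons_append, List.nil_append,
        List.length_cons, List.length_nil] at hk h0
      interval_cases k
      · simp [exposed]
      · cases p <;> simp at h0
    · have e : exposed (.node () l r) = exposed l ∪ (fun k => l.numLeaves + k) '' exposed r := by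
        rcases l with _ | _ <;> rcases r with _ | _ <;> first | rfl | simp at hn
      rw [e]
      match p with
      | [] =>
        have m0 := List.mem_of_getElem? h0
        simp only [leafAddrs, List.nil_append, List.mem_append, List.mem_map, List.cons.injEq] at m0 h1
        simp at m0 h1
        exact absurd ⟨nil_of_nil_mem_leafAddrs m0, nil_of_nil_mem_leafAddrs h1⟩ hn
      | false :: p =>
        left
        refine hl (p := p) ?_ (by simpa [leafAddrs] using h1)
        rcases Nat.lt_or_ge k l.numLeaves with hk | hk
        · rw [leafAddrs, List.getElem?_append_left (by simpa using hk)] at h0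
          simpa using h0
        · rw [leafAddrs, List.getElem?_append_right (by simpa using hk)] at h0
          simp at h0
      | true :: p =>
        right
        rcases Nat.lt_or_ge k l.numLeaves with hk | hk
        · rw [leafAddrs, List.getElem?_append_left (by simpa using hk)] at h0
          simp at h0
        · rw [leafAddrs, List.getElem?_append_right (by simpa using hk)] at h0
          refine ⟨k - l.numLeaves, hr (p := p) ?_ (by simpa [leafAddrs] using h1), by simp; omega⟩
          simpa using h0

/-- Below each inner node there is an exposed caret. -/
lemma exists_exposed_below {t : BTree} {p : List Bool} (hp : p ∈ nodeAddrs t) :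
    ∃ q, (p ++ q) ++ [false] ∈ leafAddrs t ∧ (p ++ q) ++ [true] ∈ leafAddrs t := by
  induction t generalizing p with
  | nil => simp [nodeAddrs] at hp
  | node _ l r hl hr =>
    match p with
    | [] =>
      by_cases h : l = .nil ∧ r = .nil
      · obtain ⟨rfl, rfl⟩ := h
        exact ⟨[], by simp [leafAddrs]⟩
      · rcases l with _ | ⟨_, l1, l2⟩
        · rcases r with _ | ⟨_, r1, r2⟩
          · simp at h
          · obtain ⟨q, h0, h1⟩ := hr (p := []) (by simp [nodeAddrs])
            refine ⟨true :: q, ?_⟩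
            rw [leafAddrs]
            simpa using ⟨h0, h1⟩
        · obtain ⟨q, h0, h1⟩ := hl (p := []) (by simp [nodeAddrs])
          refine ⟨false :: q, ?_⟩
          rw [leafAddrs]
          simpa using ⟨h0, h1⟩
    | false :: p =>
      obtain ⟨q, h0, h1⟩ := hl (p := p) (by simpa [nodeAddrs] using hp)
      exact ⟨q, by simpa [leafAddrs] using h0, by simpa [leafAddrs] using h1⟩
    | true :: p =>
      obtain ⟨q, h0, h1⟩ := hr (p := p) (by simpa [nodeAddrs] using hp)
      exact ⟨q, by simpa [leafAddrs] using h0, by simpa [leafAddrs] using h1⟩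

/-! ### Good and bad intervals -/

/-- `w` does not map the standard dyadic interval `p` affinely onto a standard dyadic interval. -/
def Bad (w : T) (p : List Bool) : Prop := ∀ q, ¬ Maps w p q

/-- An affine map restricts to subintervals, so bad addresses form a prefix-closed set, as the inner
nodes of a tree must. -/
lemma Bad.of_append {w : T} {p q : List Bool} (h : Bad w (p ++ q)) : Bad w p :=
  fun _ hr => h _ (hr.append q)

/-! ### Finiteness of the set of bad addresses -/

/-- Every dyadic interval of length `2 ^ (-n)` with left endpoint a multiple of `2 ^ (-n)` is
standard modulo `1`. -/
lemma exists_address (n : ℕ) (a : ℤ) : ∃ (q : List Bool) (k : ℤ),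
    q.length = n ∧ pt q 0 = a / 2 ^ n + k := by
  induction n generalizing a with
  | zero => exact ⟨[], -a, rfl, by simp [pt]⟩
  | succ n ih =>
    obtain ⟨q, k, hq, e⟩ := ih a
    -- Halving the interval halves the integer shift as well, so the parity of `k` is the new
    -- leading bit.
    rcases Int.even_or_odd' k with ⟨c, rfl | rfl⟩
    · refine ⟨false :: q, c, by simp [hq], ?_⟩
      simp only [pt, e]; push_cast; field_simp; ring
    · refine ⟨true :: q, c + 1, by simp [hq], ?_⟩
      simp only [pt, e]; push_cast; field_simp; ring

lemma exists_pt_zero_eq (p : List Bool) : ∃ a : ℤ, pt p 0 = a / 2 ^ p.length := by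
  induction p with
  | nil => exact ⟨0, by simp [pt]⟩
  | cons b p ih =>
    obtain ⟨a, ha⟩ := ih
    cases b
    · exact ⟨a, by simp only [pt, ha, List.length_cons]; field_simp; ring⟩
    · exact ⟨2 ^ p.length + a, by
        simp only [pt, ha, List.length_cons]; push_cast; field_simp; ring⟩

/-- A continuous function which is locally affine with slopes powers of two on an open
interval is affine on its closure. -/
lemma affine_of_locally_affine {F : ℝ → ℝ} (hF : Continuous F) {a b : ℝ} (hab : a < b)
    (h : ∀ x ∈ Set.Ioo a b, ∃ m : ℤ, ∀ᶠ y in 𝓝 x, F y = F x + 2 ^ m * (y - x)) :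
    ∃ m : ℤ, ∀ y ∈ Set.Icc a b, F y = F a + 2 ^ m * (y - a) := by
  have hder : ∀ x (m : ℤ), (∀ᶠ y in 𝓝 x, F y = F x + 2 ^ m * (y - x)) →
      deriv F x = 2 ^ m := by
    intro x m hm
    have h1 : HasDerivAt (fun y => F x + 2 ^ m * (y - x)) (2 ^ m * 1) x :=
      (((hasDerivAt_id x).sub_const x).const_mul _).const_add _
    rw [mul_one] at h1
    exact (h1.congr_of_eventuallyEq hm).deriv
  -- Slope and intercept of the tangent line: locally constant, hence constant on the connected open
  -- interval.
  let φ : Set.Ioo a b → ℝ × ℝ := fun x => (deriv F x, F x - deriv F x * x)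
  have hφ : IsLocallyConstant φ := by
    rw [IsLocallyConstant.iff_eventually_eq]
    rintro ⟨x, hx⟩
    obtain ⟨m, hm⟩ := h x hx
    have hm' : ∀ᶠ y in 𝓝 x, deriv F y = 2 ^ m ∧ F y = F x + 2 ^ m * (y - x) := by
      filter_upwards [hm.eventually_nhds, hm] with y hy hy'
      refine ⟨hder y m ?_, hy'⟩
      filter_upwards [hy] with z hz
      rw [hz, hy']; ring
    have := (continuous_subtype_val (p := (· ∈ Set.Ioo a b))).continuousAt (x := ⟨x, hx⟩)
    filter_upwards [this.eventually hm'] with y hy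
    simp only [φ, Prod.mk.injEq, hy.1, hder x m hm, true_and]
    rw [hy.2]; ring
  have : PreconnectedSpace (Set.Ioo a b) := isPreconnected_iff_preconnectedSpace.1 isPreconnected_Ioo
  have hmem : (a + b) / 2 ∈ Set.Ioo a b := ⟨by linarith, by linarith⟩
  obtain ⟨m, hm⟩ := h _ hmem
  have hmid := hder _ _ hm
  set c := F ((a + b) / 2) - 2 ^ m * ((a + b) / 2) with hc
  have hIoo : Set.EqOn F (fun y => 2 ^ m * y + c) (Set.Ioo a b) := by
    intro y hy
    have := hφ.apply_eq_of_preconnectedSpace ⟨y, hy⟩ ⟨_, hmem⟩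
    simp only [φ, Prod.mk.injEq, hmid] at this
    obtain ⟨h1, h2⟩ := this
    rw [h1] at h2
    simp only [hc]; linarith
  have hIcc : Set.EqOn F (fun y => 2 ^ m * y + c) (Set.Icc a b) := by
    rw [← closure_Ioo hab.ne]
    exact hIoo.closure hF (by fun_prop)
  refine ⟨m, fun y hy => ?_⟩
  rw [hIcc hy, hIcc (Set.left_mem_Icc.2 hab.le)]
  ring

lemma exists_common_denominator (B : Finset ℝ) (hB : ∀ b ∈ B, IsDyadic b) :
    ∃ n : ℕ, ∀ b ∈ B, ∃ a : ℤ, b = a / 2 ^ n := by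
  classical
  induction B using Finset.induction_on with
  | empty => exact ⟨0, by simp⟩
  | insert b B _ ih =>
    obtain ⟨n, hn⟩ := ih fun b hb => hB b (Finset.mem_insert_of_mem hb)
    obtain ⟨a, m, e⟩ := hB b (Finset.mem_insert_self _ _)
    refine ⟨m + n, fun b' hb' => ?_⟩
    rcases Finset.mem_insert.1 hb' with rfl | hb'
    · exact ⟨a * 2 ^ n, by rw [e]; push_cast; field_simp; ring⟩
    · obtain ⟨a', e'⟩ := hn b' hb'
      exact ⟨a' * 2 ^ m, by rw [e']; push_cast; field_simp; ring⟩

/-- Sufficiently short standard dyadic intervals inside an interval where a lift is affine are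
mapped onto standard dyadic intervals. -/
lemma exists_forall_maps_append (w : T) {F : ℝ ≃o ℝ} (hF : IsThompsonLift F)
    (hw : ∀ t : ℝ, w.1 (t : UnitAddCircle) = (F t : ℝ)) (p : List Bool) (m : ℤ)
    (hm : ∀ t, 0 ≤ t → t ≤ 1 → F (pt p t) = F (pt p 0) + 2 ^ m * (pt p t - pt p 0)) :
    ∃ s : ℕ, ∀ r : List Bool, s ≤ r.length → ¬ Bad w (p ++ r) := by
  obtain ⟨a, n, ha⟩ : IsDyadic (F (pt p 0)) := by
    obtain ⟨a, ha⟩ := exists_pt_zero_eq p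
    exact (hF.dyadic_iff _).2 ⟨a, _, ha⟩
  -- The image of `p ++ r` has length `2 ^ (-N)` with `N = p.length + r.length - m`. The bound on
  -- `r.length` gives `n ≤ N`, so the image starts at a multiple of `2 ^ (-N)`.
  refine ⟨n + m.natAbs, fun r hr hbad => ?_⟩
  obtain ⟨b, hb⟩ := exists_pt_zero_eq r
  obtain ⟨N, hN⟩ : ∃ N : ℕ, (N : ℤ) = p.length + r.length - m :=
    ⟨(p.length + r.length - m).toNat, by omega⟩
  obtain ⟨M, hM⟩ : ∃ M : ℕ, N = n + M := ⟨N - n, by omega⟩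
  obtain ⟨q, k, hq, e⟩ := exists_address N (a * 2 ^ M + b)
  refine hbad q fun t h0 h1 => ?_
  have e1 : (2 : ℝ) ^ m * 2 ^ N = 2 ^ p.length * 2 ^ r.length := by
    rw [← zpow_natCast 2 N, hN, ← zpow_add₀ two_ne_zero, ← pow_add, ← zpow_natCast]
    congr 1
    push_cast
    ring
  have e2 : (2 : ℝ) ^ N = 2 ^ n * 2 ^ M := by rw [hM, pow_add]
  have e3 : pt q t = F (pt (p ++ r) t) + k := by
    rw [pt_append, hm _ (pt_nonneg r h0) (pt_le_one r h1), ha, pt_eq p (pt r t), pt_eq r t, hb,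
      pt_eq q t, hq, e]
    have e4 : (2 : ℝ) ^ m = 2 ^ p.length * 2 ^ r.length / 2 ^ N := by
      rw [← e1]; field_simp
    rw [e4, e2]
    simp only [one_div, inv_pow, e2]
    push_cast
    field_simp
    ring
  have e5 : ((k : ℝ) : UnitAddCircle) = 0 := AddCircle.coe_eq_zero_iff 1 |>.2 ⟨k, by simp⟩
  rw [hw, e3, AddCircle.coe_add, e5, add_zero]

/-- Choose a level whose grid contains all breakpoints. A lift is then affine on each interval of
that level, and sufficiently deep subintervals are good; as there are finitely many intervals of
that level, one depth serves them all. -/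
lemma exists_level (w : T) : ∃ L : ℕ, ∀ p : List Bool, L ≤ p.length → ¬ Bad w p := by
  obtain ⟨F, hF, hw⟩ := w.2
  obtain ⟨B, hB, hp⟩ := hF.pieces
  obtain ⟨n, hn⟩ := exists_common_denominator B hB
  have key : ∀ p : List Bool, ∃ s : ℕ, p.length = n →
      ∀ r : List Bool, s ≤ r.length → ¬ Bad w (p ++ r) := by
    intro p
    by_cases hl : p.length = n
    swap
    · exact ⟨0, fun h => absurd h hl⟩
    have hlt : pt p 0 < pt p 1 := pt_strictMono p one_pos
    -- No breakpoint is interior: otherwise `2 ^ n * x` would be an integer strictly between the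
    -- consecutive integers `b` and `b + 1`.
    obtain ⟨m, hm⟩ := affine_of_locally_affine F.continuous hlt fun x hx => hp x fun hmem => by
      obtain ⟨a, ha⟩ := hn _ hmem
      obtain ⟨b, hb⟩ := exists_pt_zero_eq p
      have hx' : x = (a + 2 ^ n * ⌊x⌋ : ℤ) / 2 ^ n := by
        push_cast
        rw [add_div, ← ha, mul_div_cancel_left₀ _ (by positivity), Int.fract]; ring
      have hpos : (0 : ℝ) < 2 ^ n := by positivity
      obtain ⟨h1, h2⟩ := hx
      rw [pt_eq p 1, hb, hl, hx', one_mul, one_div, inv_pow, ← one_div, ← add_div,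
        div_lt_div_iff_of_pos_right hpos] at h2
      rw [hb, hl, hx', div_lt_div_iff_of_pos_right hpos] at h1
      norm_cast at h1 h2
      omega
    obtain ⟨s, hs⟩ := exists_forall_maps_append w hF hw p m fun t h0 h1 =>
      hm _ ⟨(pt_strictMono p).monotone h0, (pt_strictMono p).monotone h1⟩
    exact ⟨s, fun _ => hs⟩
  choose s hs using key
  have hfin : {p : List Bool | p.length = n}.Finite := List.finite_length_eq Bool n
  refine ⟨n + hfin.toFinset.sup s, fun p hp => ?_⟩
  have h1 : (p.take n).length = n := by simp; omega
  have h2 : s (p.take n) ≤ hfin.toFinset.sup s := Finset.le_sup (by simpa using h1)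
  have := hs (p.take n) h1 (p.drop n) (by simp; omega)
  rwa [List.take_append_drop] at this

lemma exists_badTree (w : T) : ∃ t : BTree, ∀ p, p ∈ nodeAddrs t ↔ Bad w p :=
  let ⟨_, hL⟩ := exists_level w
  exists_tree_of_prefix_closed (fun _ _ => Bad.of_append) hL

/-- The tree whose inner nodes are the intervals that `w` does not map affinely onto standard
dyadic intervals. -/
def badTree (w : T) : BTree := (exists_badTree w).choose

lemma mem_badTree {w : T} {p : List Bool} : p ∈ nodeAddrs (badTree w) ↔ Bad w p :=
  (exists_badTree w).choose_spec p

/-! ### Existence and uniqueness of the reduced diagram -/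

/-- `w` maps the leaves of `s` onto the leaves of `t`, the first one going to the leaf number `m`. -/
def Rep (w : T) (s t : BTree) (m : ℕ) : Prop :=
  List.Forall₂ (Maps w) (leafAddrs s) ((leafAddrs t).rotate m)

lemma rep_iff {w : T} {s t : BTree} {m : ℕ} : Rep w s t m ↔
    s.numLeaves = t.numLeaves ∧ ∀ k (h : k < (leafAddrs s).length)
      (h' : (m + k) % t.numLeaves < (leafAddrs t).length),
      Maps w (leafAddrs s)[k] (leafAddrs t)[(m + k) % t.numLeaves] := by
  rw [Rep, List.forall₂_iff_get]
  simp only [List.length_rotate, length_leafAddrs, List.get_eq_getElem, List.getElem_rotate,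
    add_comm m]
  refine and_congr_right fun e => forall_congr' fun k => ⟨fun H h _ => H h (e ▸ h), fun H h _ => ?_⟩
  exact H h (Nat.mod_lt _ (by omega))

lemma TreePair.represents_iff {d : TreePair} {w : T} :
    d.Represents w ↔ Rep w d.source d.target d.mark := by
  rw [rep_iff, and_iff_right d.numLeaves_eq]
  have hl : d.leaves = d.target.numLeaves := rfl
  have hpair (k : ℕ) : d.pairing k = (d.mark + k) % d.target.numLeaves := rfl
  refine forall_congr' fun k => ⟨fun H hk hk' t h0 h1 => ?_, fun H hk t h0 h1 => ?_⟩
  · have := H (by simpa [hl, d.numLeaves_eq] using hk) t h0 h1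
    rwa [hpair, leafInterval_point _ hk, leafInterval_point _ hk'] at this
  · have hk1 : k < (leafAddrs d.source).length := by simpa [hl, d.numLeaves_eq] using hk
    have hk2 : d.pairing k < (leafAddrs d.target).length := by
      rw [length_leafAddrs]; exact Nat.mod_lt _ d.target.numLeaves_pos
    rw [leafInterval_point _ hk1, leafInterval_point _ hk2]
    exact H hk1 hk2 t h0 h1

lemma Rep.exists_of_mem_source {w : T} {s t : BTree} {m : ℕ} (h : Rep w s t m) {p : List Bool}
    (hp : p ∈ leafAddrs s) : ∃ q ∈ leafAddrs t, Maps w p q := by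
  obtain ⟨k, hk, rfl⟩ := List.getElem_of_mem hp
  have := (rep_iff.1 h).2 k hk (by simpa using Nat.mod_lt _ t.numLeaves_pos)
  exact ⟨_, List.getElem_mem _, this⟩

/-- An address that is not a node lies at or below a leaf, where `w` is affine. Hence `badTree w`
sits inside the source of every diagram of `w`. -/
lemma Rep.nodeAddrs_subset {w : T} {s t : BTree} {m : ℕ} (h : Rep w s t m) {p : List Bool}
    (hp : Bad w p) : p ∈ nodeAddrs s := by
  by_contra hn
  obtain ⟨q, hq, r, rfl⟩ := exists_leaf_prefix hn
  obtain ⟨q', -, hq'⟩ := h.exists_of_mem_source hq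
  exact hp _ (hq'.append r)

/-- An element is determined by a diagram that represents it. -/
lemma Rep.unique {w w' : T} {s t : BTree} {m : ℕ} (h : Rep w s t m) (h' : Rep w' s t m) :
    w = w' := by
  refine Subtype.ext (Homeomorph.ext fun y => ?_)
  have hp : Fact ((0 : ℝ) < 1) := ⟨one_pos⟩
  obtain ⟨x, hx, rfl⟩ := AddCircle.coe_image_Icc_eq (p := (1 : ℝ)) 0 ▸ Set.mem_univ y
  obtain ⟨p, hp, u, h0, h1, rfl⟩ := exists_leafAddrs_point s hx.1 (by simpa using hx.2)
  obtain ⟨k, hk, rfl⟩ := List.getElem_of_mem hp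
  have hk' : (m + k) % t.numLeaves < (leafAddrs t).length := by
    simpa using Nat.mod_lt _ t.numLeaves_pos
  rw [(rep_iff.1 h).2 k hk hk' u h0 h1, (rep_iff.1 h').2 k hk hk' u h0 h1]

/-- If `w` induces a bijection between the leaves of two trees, then it preserves their cyclic
order. -/
lemma exists_rep_of_maps {w : T} {s t : BTree}
    (h : ∀ p ∈ leafAddrs s, ∃ q ∈ leafAddrs t, Maps w p q)
    (h' : ∀ q ∈ leafAddrs t, ∃ p ∈ leafAddrs s, Maps w p q) :
    ∃ m < t.numLeaves, Rep w s t m := by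
  choose! φ hφ hw using h
  have hinj : Set.InjOn φ {p | p ∈ leafAddrs s} := fun p hp p' hp' e =>
    (hw p hp).left_unique (e ▸ hw p' hp')
  have hperm : ((leafAddrs s).map φ).Perm (leafAddrs t) := by
    rw [List.perm_ext_iff_of_nodup ((nodup_leafAddrs s).map_on fun p hp q hq e => hinj hp hq e)
      (nodup_leafAddrs t)]
    refine fun q => ⟨fun hq => ?_, fun hq => ?_⟩
    · obtain ⟨p, hp, rfl⟩ := List.mem_map.1 hq
      exact hφ p hp
    · obtain ⟨p, hp, hpq⟩ := h' q hq
      exact List.mem_map.2 ⟨p, hp, (hw p hp).right_unique hpq⟩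
  have hlen : s.numLeaves = t.numLeaves := by simpa using hperm.length_eq
  have h0 : 0 < (leafAddrs s).length := by simpa using s.numLeaves_pos
  obtain ⟨m, hm, em⟩ := List.getElem_of_mem (hφ _ (List.getElem_mem h0))
  refine ⟨m, by simpa using hm, rep_iff.2 ⟨hlen, fun k => ?_⟩⟩
  induction k with
  | zero =>
    intro _ hk'
    have : (m + 0) % t.numLeaves = m := Nat.mod_eq_of_lt (by simpa using hm)
    simp only [this, em]
    exact hw _ (List.getElem_mem h0)
  | succ k ih =>
    intro hk hk'
    have hkt : (m + k) % t.numLeaves < (leafAddrs t).length := by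
      simpa using Nat.mod_lt _ t.numLeaves_pos
    have ih := ih (by omega) hkt
    have hk0 : (leafAddrs s)[k + 1] ∈ leafAddrs s := List.getElem_mem hk
    -- Leaf `k + 1` starts where leaf `k` ends, so its image starts where the image of leaf `k`
    -- ends; only one target leaf starts there.
    have e1 := leafAddrs_cyclic_succ s (k := k) (by omega)
    simp only [Nat.mod_eq_of_lt hk] at e1
    have e2 := leafAddrs_cyclic_succ t hkt
    have e3 : ((m + k) % t.numLeaves + 1) % (leafAddrs t).length = (m + (k + 1)) % t.numLeaves := by
      rw [length_leafAddrs, Nat.mod_add_mod, add_assoc]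
    simp only [e3] at e2
    have e4 := hw _ hk0 0 le_rfl zero_le_one
    rw [← e1, ih 1 zero_le_one le_rfl, e2] at e4
    have e5 := coe_circle_injOn (pt_zero_nonneg _) (pt_lt_one _ one_pos) (pt_zero_nonneg _)
      (pt_lt_one _ one_pos) e4
    rw [eq_of_mem_leafAddrs (List.getElem_mem _) (hφ _ hk0) e5]
    exact hw _ hk0

/-- The leaves of `badTree w` are mapped onto leaves of `badTree w⁻¹`. -/
lemma exists_maps_badTree (w : T) {p : List Bool} (hp : p ∈ leafAddrs (badTree w)) :
    ∃ q ∈ leafAddrs (badTree w⁻¹), Maps w p q := by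
  have hgood := mt mem_badTree.2 (notMem_nodeAddrs_of_leaf hp)
  simp only [Bad, not_forall, not_not] at hgood
  obtain ⟨q, hq⟩ := hgood
  refine ⟨q, ?_, hq⟩
  have hq' : q ∉ nodeAddrs (badTree w⁻¹) := fun h => mem_badTree.1 h p hq.inv
  obtain ⟨q, hqm, r, rfl⟩ := exists_leaf_prefix hq'
  -- If the image lay strictly below a leaf of `badTree w⁻¹`, pulling that leaf back would make the
  -- parent of the source leaf good, although it is an inner node of `badTree w`.
  rcases List.eq_nil_or_concat' r with rfl | ⟨r, b, rfl⟩
  · simpa using hqm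
  exfalso
  have hgood := mt mem_badTree.2 (notMem_nodeAddrs_of_leaf hqm)
  simp only [Bad, not_forall, not_not] at hgood
  obtain ⟨p', hp'⟩ := hgood
  have e := (hp'.append (r ++ [b])).right_unique hq.inv
  have hnode : p' ++ r ∈ nodeAddrs (badTree w) :=
    mem_nodeAddrs_iff.2 ⟨b, [], by rwa [List.append_assoc, e]⟩
  refine mem_badTree.1 hnode (q ++ r) ?_
  have := hp'.inv.append r
  rwa [inv_inv] at this

/-- The trees are `badTree w` and `badTree w⁻¹`. Matching exposed carets would make an inner node of
`badTree w` good by `Maps.of_halves`. -/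
lemma exists_reducedDiagram (w : T) : ∃ d : TreePair, d.IsReducedDiagramOf w := by
  obtain ⟨m, hm, hrep⟩ := exists_rep_of_maps (w := w) (fun p => exists_maps_badTree w)
    (fun q hq => by
      obtain ⟨p, hp, h⟩ := exists_maps_badTree w⁻¹ hq
      rw [inv_inv] at hp
      exact ⟨p, hp, by simpa using h.inv⟩)
  refine ⟨⟨_, _, (rep_iff.1 hrep).1, m, hm⟩, ?_, TreePair.represents_iff.2 hrep⟩
  intro k hk hk'
  obtain ⟨p, hp0, hp1⟩ := getElem?_of_exposed hk
  obtain ⟨q, hq0, hq1⟩ := getElem?_of_exposed hk'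
  simp only [TreePair.pairing, TreePair.leaves] at hq0 hq1
  obtain ⟨a0, hp0⟩ := List.getElem?_eq_some_iff.1 hp0
  obtain ⟨a1, hp1⟩ := List.getElem?_eq_some_iff.1 hp1
  obtain ⟨b0, hq0⟩ := List.getElem?_eq_some_iff.1 hq0
  obtain ⟨b1, hq1⟩ := List.getElem?_eq_some_iff.1 hq1
  -- The right leaf of the target caret exists, so the numbering does not wrap around between the
  -- two leaves of the caret.
  have e : (m + (k + 1)) % (badTree w⁻¹).numLeaves = (m + k) % (badTree w⁻¹).numLeaves + 1 := by
    rw [← add_assoc, ← Nat.mod_add_mod, Nat.mod_eq_of_lt (by simpa using b1)]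
  have m0 := (rep_iff.1 hrep).2 k a0 b0
  have m1 := (rep_iff.1 hrep).2 (k + 1) a1 (by omega)
  simp only [e] at m1
  rw [hp0, hq0] at m0
  rw [hp1, hq1] at m1
  have hnode : p ∈ nodeAddrs (badTree w) :=
    mem_nodeAddrs_iff.2 ⟨false, [], hp0 ▸ List.getElem_mem a0⟩
  exact mem_badTree.1 hnode q (m0.of_halves m1)

/-- The source tree of a reduced diagram of `w` is determined by `w`. -/
lemma TreePair.IsReducedDiagramOf.source_eq {d : TreePair} {w : T} (h : d.IsReducedDiagramOf w) :
    d.source = badTree w := by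
  have hrep := represents_iff.1 h.2
  refine nodeAddrs_injective (Finset.ext fun p => ?_)
  rw [mem_badTree]
  refine ⟨fun hp q hq => ?_, hrep.nodeAddrs_subset⟩
  -- If a node `p` had image `q`, an exposed caret below `p` would go to two sibling leaves below
  -- `q`, contradicting reducedness.
  obtain ⟨r, h0, h1⟩ := exists_exposed_below hp
  obtain ⟨k, hk, ek⟩ := List.getElem_of_mem h0
  have hkt : (d.mark + k) % d.target.numLeaves < (leafAddrs d.target).length := by
    simpa using Nat.mod_lt _ d.target.numLeaves_pos
  have hm := hq.append r
  obtain ⟨q1, hq1, hm1⟩ := hrep.exists_of_mem_source h1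
  have hm0 := (rep_iff.1 hrep).2 k hk hkt
  rw [ek] at hm0
  refine h.1 k (exposed_of_mem (List.getElem?_eq_some_iff.2 ⟨hk, ek⟩) h1)
    (exposed_of_mem (p := q ++ r) (List.getElem?_eq_some_iff.2 ⟨hkt, ?_⟩) ?_)
  · exact hm0.right_unique (hm.append _)
  · rwa [(hm.append _).right_unique hm1]

lemma Rep.mem_target_iff {w : T} {s t : BTree} {m : ℕ} (h : Rep w s t m) {q : List Bool} :
    q ∈ leafAddrs t ↔ ∃ p ∈ leafAddrs s, Maps w p q := by
  refine ⟨fun hq => ?_, fun ⟨p, hp, hm⟩ => ?_⟩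
  · have := List.forall₂_iff_get.1 h
    obtain ⟨k, hk, rfl⟩ := List.getElem_of_mem (List.mem_rotate.2 hq : q ∈ (leafAddrs t).rotate m)
    exact ⟨_, List.getElem_mem _, this.2 k (by omega) hk⟩
  · obtain ⟨q', hq', hm'⟩ := h.exists_of_mem_source hp
    rwa [hm.right_unique hm']

/-- The target leaves are exactly the images of the source leaves, and the leaves determine the
nodes. -/
lemma Rep.target_unique {w : T} {s t t' : BTree} {m m' : ℕ} (h : Rep w s t m)
    (h' : Rep w s t' m') : t = t' := by
  refine nodeAddrs_injective (Finset.ext fun p => ?_)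
  simp only [mem_nodeAddrs_iff, h.mem_target_iff, h'.mem_target_iff]

lemma Rep.mark_unique {w : T} {s t : BTree} {m m' : ℕ} (hm : m < t.numLeaves)
    (hm' : m' < t.numLeaves) (h : Rep w s t m) (h' : Rep w s t m') : m = m' := by
  rw [rep_iff] at h h'
  have h0 : 0 < (leafAddrs s).length := by simpa using s.numLeaves_pos
  have a := h.2 0 h0 (by simpa using Nat.mod_lt _ t.numLeaves_pos)
  have a' := h'.2 0 h0 (by simpa using Nat.mod_lt _ t.numLeaves_pos)
  simp only [add_zero, Nat.mod_eq_of_lt hm, Nat.mod_eq_of_lt hm'] at a a'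
  exact (nodup_leafAddrs t).getElem_inj_iff.1 (a.right_unique a')

lemma existsUnique_reducedDiagram (w : T) : ∃! d : TreePair, d.IsReducedDiagramOf w := by
  refine existsUnique_of_exists_of_unique (exists_reducedDiagram w) fun d d' h h' => ?_
  have hs : d.source = d'.source := h.source_eq.trans h'.source_eq.symm
  have r := TreePair.represents_iff.1 h.2
  have r' := TreePair.represents_iff.1 h'.2
  rw [← hs] at r'
  have ht := r.target_unique r'
  rw [← ht] at r'
  exact TreePair.ext hs ht (r.mark_unique d.mark_lt (ht ▸ d'.mark_lt) r')

lemma reducedDiagram_spec (w : T) : (reducedDiagram w).IsReducedDiagramOf w := by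
  rw [reducedDiagram, dif_pos (exists_reducedDiagram w)]
  exact (exists_reducedDiagram w).choose_spec

/-! ### The number of carets -/

/-- This description of `N` does not mention diagrams, so composition can be handled without finding
common refinements of trees. -/
lemma N_eq_card (w : T) : N w = (nodeAddrs (badTree w)).card := by
  rw [← (reducedDiagram_spec w).source_eq, card_nodeAddrs, N, TreePair.carets]
  have := (reducedDiagram w).numLeaves_eq
  rw [BinaryTree.numLeaves_eq_numNodes_succ, BinaryTree.numLeaves_eq_numNodes_succ] at this
  omega

/-- Split the bad addresses of `u * w`. Those bad for `w` number at most `N w`; `w` carries the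
others injectively to addresses bad for `u`, because a good image would make the composite good. -/
lemma N_mul_le (u w : T) : N (u * w) ≤ N u + N w := by
  classical
  simp only [N_eq_card]
  rw [add_comm, ← Finset.card_filter_add_card_filter_not (s := nodeAddrs (badTree (u * w))) (Bad w)]
  refine add_le_add (Finset.card_le_card fun p hp => ?_) ?_
  · exact mem_badTree.2 (Finset.mem_filter.1 hp).2
  · have : ∀ p, ∃ q, ¬ Bad w p → Maps w p q := fun p => by
      by_cases h : Bad w p
      · exact ⟨[], fun h' => absurd h h'⟩
      · obtain ⟨q, hq⟩ := not_forall.1 h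
        exact ⟨q, fun _ => not_not.1 hq⟩
    choose φ hφ using this
    refine Finset.card_le_card_of_injOn φ (fun p hp => ?_) fun p hp p' hp' e => ?_
    · obtain ⟨h1, h2⟩ := Finset.mem_filter.1 hp
      refine mem_badTree.2 fun q hq => mem_badTree.1 h1 q (hq.mul (hφ p h2))
    · exact (hφ p (Finset.mem_filter.1 hp).2).left_unique
        (e ▸ hφ p' (Finset.mem_filter.1 hp').2)

lemma N_one : N 1 = 0 := by
  rw [N_eq_card, Finset.card_eq_zero, Finset.eq_empty_iff_forall_notMem]
  exact fun p hp => mem_badTree.1 hp p (Maps.one p)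

/-! ### Composition of diagrams -/

lemma Rep.one (t : BTree) : Rep 1 t t 0 := by
  rw [Rep, List.rotate_zero, List.forall₂_same]
  exact fun p _ => Maps.one p

/-- With a common middle tree the pairings compose directly, and the two rotations add. -/
lemma Rep.mul {u w : T} {s t r : BTree} {m m' : ℕ} (hu : Rep u t r m') (hw : Rep w s t m) :
    Rep (u * w) s r (m + m') := by
  rw [rep_iff] at *
  refine ⟨hw.1.trans hu.1, fun k h h' => ?_⟩
  have hk : (m + k) % t.numLeaves < (leafAddrs t).length := by
    simpa using Nat.mod_lt _ t.numLeaves_pos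
  have e : (m' + (m + k) % t.numLeaves) % r.numLeaves = (m + m' + k) % r.numLeaves := by
    rw [hu.1, Nat.add_mod_mod]; congr 1; ring
  have := (hu.2 _ hk (by rwa [e])).mul (hw.2 k h hk)
  simpa only [e] using this

lemma Rep.inv {w : T} {s t : BTree} (hw : Rep w s t 0) : Rep w⁻¹ t s 0 := by
  rw [Rep, List.rotate_zero] at *
  exact (List.Forall₂.imp (fun _ _ h => h.inv) hw).flip

lemma Rep.congr_mark {w : T} {s t : BTree} {m m' : ℕ} (hw : Rep w s t m)
    (h : m % t.numLeaves = m' % t.numLeaves) : Rep w s t m' := by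
  rw [Rep, ← List.rotate_mod, length_leafAddrs, ← h, ← length_leafAddrs, List.rotate_mod]
  exact hw

lemma Rep.pow {w : T} {t : BTree} {m : ℕ} (h : Rep w t t m) (j : ℕ) : Rep (w ^ j) t t (j * m) := by
  induction j with
  | zero => simpa using Rep.one t
  | succ j ih => rw [pow_succ, add_mul, one_mul, add_comm]; exact ih.mul h

lemma Maps.forall₂_map {w : T} {p q : List Bool} (h : Maps w p q) (l : List (List Bool)) :
    List.Forall₂ (Maps w) (l.map (p ++ ·)) (l.map (q ++ ·)) := by
  rw [List.forall₂_map_left_iff, List.forall₂_map_right_iff, List.forall₂_same]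
  exact fun r _ => h.append r

/-! ### Action of the generators on standard dyadic intervals -/

lemma IsFundamental.extend_eq {h : ℝ → ℝ} (hh : IsFundamental h) {t : ℝ} (h0 : 0 ≤ t)
    (h1 : t ≤ 1) : extend h t = h t := by
  rcases h1.lt_or_eq with h1 | rfl
  · rw [extend, Int.floor_eq_zero_iff.2 ⟨h0, h1⟩, Int.fract_eq_self.2 ⟨h0, h1⟩]; simp
  · rw [extend, hh.map_one]; simp [add_comm]

lemma maps_x {n : ℕ} {p q : List Bool}
    (h : ∀ t, 0 ≤ t → t ≤ 1 → xFun n (pt p t) = pt q t) : Maps (x n) p q := fun t h0 h1 => by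
  change ((extend (xFun n) (pt p t) : ℝ) : UnitAddCircle) = _
  rw [(isFundamental_xFun n).extend_eq (pt_nonneg p h0) (pt_le_one p h1), h t h0 h1]

/-- The lift `cFun n` starts at `1 - 1 / 2 ^ (n + 1)` and passes `1`, so its values agree with
points of `[0, 1]` only up to an integer `k`. -/
lemma maps_c {n : ℕ} {p q : List Bool} (k : ℤ)
    (h : ∀ t, 0 ≤ t → t ≤ 1 → cFun n (pt p t) = pt q t + k) : Maps (c n) p q := fun t h0 h1 => by
  change ((extend (cFun n) (pt p t) : ℝ) : UnitAddCircle) = _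
  have e5 : ((k : ℝ) : UnitAddCircle) = 0 := AddCircle.coe_eq_zero_iff 1 |>.2 ⟨k, by simp⟩
  rw [(isFundamental_cFun n).extend_eq (pt_nonneg p h0) (pt_le_one p h1), h t h0 h1,
    AddCircle.coe_add, e5, add_zero]

lemma pt_replicate_append (n : ℕ) (p : List Bool) (t : ℝ) :
    pt (List.replicate n true ++ p) t = 1 - (1 - pt p t) * (1 / 2 ^ n) := by
  induction n with
  | zero => simp
  | succ n ih =>
    rw [List.replicate_succ, List.cons_append, pt, ih]
    field_simp
    ring

lemma pt_replicate (n : ℕ) (t : ℝ) :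
    pt (List.replicate n true) t = 1 - (1 - t) * (1 / 2 ^ n) := by
  simpa [pt] using pt_replicate_append n [] t

lemma maps_x_of_lt {n i : ℕ} (h : i < n) :
    Maps (x n) (List.replicate i true ++ [false]) (List.replicate i true ++ [false]) := by
  refine maps_x fun t h0 h1 => ?_
  have e : (1 : ℝ) / 2 ^ n ≤ 1 / 2 ^ i / 2 := by
    rw [div_div, ← pow_succ]
    exact one_div_le_one_div_of_le (by positivity) (pow_le_pow_right₀ one_le_two h)
  have hd : (0 : ℝ) < 1 / 2 ^ n := by positivity
  have hd' : (0 : ℝ) < 1 / 2 ^ i := by positivity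
  simp only [pt_replicate_append, pt, xFun]
  generalize (1 : ℝ) / 2 ^ n = d at *
  generalize (1 : ℝ) / 2 ^ i = d' at *
  have : t * d' ≤ d' := mul_le_of_le_one_left hd'.le h1
  rw [min_eq_left (by linarith), max_eq_left (a := max _ _)
    (le_max_of_le_left (by linarith)), max_eq_left (by linarith)]

lemma maps_x_left (n : ℕ) :
    Maps (x n) (List.replicate n true ++ [false]) (List.replicate n true ++ [false, false]) := by
  refine maps_x fun t h0 h1 => ?_
  have hd : (0 : ℝ) < 1 / 2 ^ n := by positivity
  simp only [pt_replicate_append, pt, xFun]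
  generalize (1 : ℝ) / 2 ^ n = d at *
  have h2 : t * d ≤ d := mul_le_of_le_one_left hd.le h1
  have h3 : 0 ≤ t * d := by positivity
  rw [min_eq_right (by linarith), max_eq_left (a := max _ _)
    (le_max_of_le_left (by linarith)), max_eq_left (by linarith)]
  ring

lemma maps_x_mid (n : ℕ) :
    Maps (x n) (List.replicate n true ++ [true, false])
      (List.replicate n true ++ [false, true]) := by
  refine maps_x fun t h0 h1 => ?_
  have hd : (0 : ℝ) < 1 / 2 ^ n := by positivity
  simp only [pt_replicate_append, pt, xFun]
  generalize (1 : ℝ) / 2 ^ n = d at *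
  have h2 : t * d ≤ d := mul_le_of_le_one_left hd.le h1
  have h3 : 0 ≤ t * d := by positivity
  rw [min_eq_right (by linarith), max_eq_left (a := max _ _)
    (le_max_of_le_right (by linarith)), max_eq_right (by linarith)]
  ring

lemma maps_x_right (n : ℕ) :
    Maps (x n) (List.replicate n true ++ [true, true]) (List.replicate n true ++ [true]) := by
  refine maps_x fun t h0 h1 => ?_
  have hd : (0 : ℝ) < 1 / 2 ^ n := by positivity
  simp only [pt_replicate_append, pt, xFun]
  generalize (1 : ℝ) / 2 ^ n = d at *
  have h2 : t * d ≤ d := mul_le_of_le_one_left hd.le h1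
  have h3 : 0 ≤ t * d := by positivity
  rw [min_eq_right (by linarith), max_eq_right (a := max _ _)
    (max_le (by linarith) (by linarith))]
  ring

lemma one_div_two_pow_succ_le (n : ℕ) : (1 : ℝ) / 2 ^ (n + 1) ≤ 1 / 2 := by
  refine one_div_le_one_div_of_le (by norm_num) ?_
  exact le_self_pow₀ one_le_two n.succ_ne_zero

lemma cFun_eq (n : ℕ) (t : ℝ) : cFun n t =
    min (max (2 * (1 / 2 ^ (n + 1)) * t + 1 - 1 / 2 ^ (n + 1)) (2 * t))
      (t + 1 - 1 / 2 ^ (n + 1)) := by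
  have : (1 : ℝ) / 2 ^ n = 2 * (1 / 2 ^ (n + 1)) := by rw [pow_succ]; field_simp
  rw [cFun, this]

lemma maps_c_first (n : ℕ) : Maps (c n) [false] (List.replicate (n + 1) true) := by
  refine maps_c 0 fun t h0 h1 => ?_
  have hd : (0 : ℝ) < 1 / 2 ^ (n + 1) := by positivity
  have hd' := one_div_two_pow_succ_le n
  simp only [pt_replicate, pt, cFun_eq]
  generalize (1 : ℝ) / 2 ^ (n + 1) = d at *
  have h2 : 0 ≤ (1 - t) * (1 - d) := mul_nonneg (by linarith) (by linarith)
  have h3 : 0 ≤ t * (1 - 2 * d) := mul_nonneg h0 (by linarith)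
  rw [max_eq_left (by linarith), min_eq_left (by linarith)]
  push_cast; ring

lemma maps_c_mid {n k : ℕ} (h : k < n) : Maps (c n) (List.replicate (k + 1) true ++ [false])
    (List.replicate k true ++ [false]) := by
  refine maps_c 1 fun t h0 h1 => ?_
  have hd : (0 : ℝ) < 1 / 2 ^ (n + 1) := by positivity
  have hd2 : (0 : ℝ) < 1 / 2 ^ (k + 1) := by positivity
  have hd' := one_div_two_pow_succ_le n
  have hd3 := one_div_two_pow_succ_le k
  have e : (1 : ℝ) / 2 ^ (n + 1) ≤ 1 / 2 ^ (k + 1) / 2 := by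
    rw [div_div, ← pow_succ]
    exact one_div_le_one_div_of_le (by positivity) (pow_le_pow_right₀ one_le_two (by omega))
  have e' : (1 : ℝ) / 2 ^ k = 2 * (1 / 2 ^ (k + 1)) := by rw [pow_succ]; field_simp
  simp only [pt_replicate_append, pt, cFun_eq]
  rw [e']
  generalize (1 : ℝ) / 2 ^ (n + 1) = d at *
  generalize (1 : ℝ) / 2 ^ (k + 1) = d' at *
  have h2 : t * d' ≤ d' := mul_le_of_le_one_left hd2.le h1
  have h3 : 0 ≤ t * d' := by positivity
  have h4 : 0 ≤ (1 - d) * (1 - 2 * ((1 - t / 2) * d')) := mul_nonneg (by linarith) (by linarith)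
  rw [max_eq_right (by linarith), min_eq_left (by linarith)]
  push_cast; ring

lemma maps_c_last (n : ℕ) :
    Maps (c n) (List.replicate (n + 1) true) (List.replicate n true ++ [false]) := by
  refine maps_c 1 fun t h0 h1 => ?_
  have hd : (0 : ℝ) < 1 / 2 ^ (n + 1) := by positivity
  have hd' := one_div_two_pow_succ_le n
  have e' : (1 : ℝ) / 2 ^ n = 2 * (1 / 2 ^ (n + 1)) := by rw [pow_succ]; field_simp
  simp only [pt_replicate_append, pt_replicate, pt, cFun_eq]
  rw [e']
  generalize (1 : ℝ) / 2 ^ (n + 1) = d at *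
  have h2 : 0 ≤ t * d := by positivity
  have h4 : 0 ≤ (1 - d) * (1 - 2 * ((1 - t) * d)) := by
    refine mul_nonneg (by linarith) ?_
    linarith [mul_le_of_le_one_left hd.le h1]
  rw [max_eq_right (by linarith), min_eq_right (by linarith)]
  push_cast; ring

/-! ### Forests on the right side of a tree -/

/-- The tree whose right side carries the given left subtrees. -/
def spine : List BTree → BTree
  | [] => .nil
  | l :: F => .node () l (spine F)

lemma exists_spine_eq (t : BTree) : ∃ F, t = spine F := by
  induction t with
  | nil => exact ⟨[], rfl⟩
  | node _ l r _ hr =>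
    obtain ⟨F, rfl⟩ := hr
    exact ⟨l :: F, rfl⟩

/-- The tree with `n` carets all of which are on the right side. -/
def allRight (n : ℕ) : BTree := spine (List.replicate n .nil)

lemma numNodes_allRight (n : ℕ) : (allRight n).numNodes = n := by
  induction n with
  | zero => rfl
  | succ n ih => simpa [allRight, List.replicate_succ, spine, BinaryTree.numNodes] using ih

lemma numLeaves_allRight (n : ℕ) : (allRight n).numLeaves = n + 1 := by
  rw [BinaryTree.numLeaves_eq_numNodes_succ, numNodes_allRight]

lemma leafAddrs_allRight_getElem? (n k : ℕ) (hk : k ≤ n) : (leafAddrs (allRight n))[k]? =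
    some (if k = n then List.replicate n true else List.replicate k true ++ [false]) := by
  induction n generalizing k with
  | zero => simp [show k = 0 by omega, allRight, spine, leafAddrs]
  | succ n ih =>
    have e : leafAddrs (allRight (n + 1)) =
        [false] :: (leafAddrs (allRight n)).map (true :: ·) := rfl
    rw [e]
    cases k with
    | zero => simp
    | succ k =>
      rw [List.getElem?_cons_succ, List.getElem?_map, ih k (by omega)]
      by_cases h : k = n <;> simp [h, List.replicate_succ]

/-- `c_n` sends each leaf of the all-right tree to the cyclically preceding one. -/
lemma rep_c (n : ℕ) : Rep (c n) (allRight (n + 1)) (allRight (n + 1)) (n + 1) := by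
  refine rep_iff.2 ⟨rfl, fun k hk hk' => ?_⟩
  have hk1 : k ≤ n + 1 := by
    rw [length_leafAddrs, numLeaves_allRight] at hk; omega
  have hk1' : (n + 1 + k) % (allRight (n + 1)).numLeaves ≤ n + 1 := by
    rw [length_leafAddrs] at hk'; rw [numLeaves_allRight] at hk' ⊢; omega
  have e := leafAddrs_allRight_getElem? (n + 1) k hk1
  have e' := leafAddrs_allRight_getElem? (n + 1) _ hk1'
  rw [List.getElem?_eq_getElem hk, Option.some.injEq] at e
  rw [List.getElem?_eq_getElem hk', Option.some.injEq] at e'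
  rw [e, e', numLeaves_allRight]
  rcases k with _ | k
  · rw [add_zero, Nat.mod_eq_of_lt (by omega), if_pos rfl, if_neg (by omega)]
    exact maps_c_first n
  · have : (n + 1 + (k + 1)) % (n + 1 + 1) = k := by
      rw [show n + 1 + (k + 1) = k + (n + 1 + 1) by ring, Nat.add_mod_right,
        Nat.mod_eq_of_lt (by omega)]
    rw [this, if_neg (show k ≠ n + 1 by omega)]
    split_ifs with h
    · rw [show k = n by omega]
      exact maps_c_last n
    · exact maps_c_mid (by omega)

/-- The half turn exchanges the two halves affinely, so it swaps arbitrary subtrees; in the target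
all leaves of `r` precede those of `l`. -/
lemma rep_c_zero (l r : BTree) : Rep (c 0) (.node () l r) (.node () r l) r.numLeaves := by
  have e : r.numLeaves = ((leafAddrs r).map (false :: ·)).length := by simp
  rw [Rep, leafAddrs, leafAddrs, e, List.rotate_append_length_eq]
  exact List.rel_append ((maps_c_first 0).forall₂_map _) ((maps_c_last 0).forall₂_map _)

/-- `x_n` joins the trees number `n` and `n + 1` on the right side. -/
lemma rep_x (F : List BTree) (l r : BTree) (G : List BTree) :
    Rep (x F.length) (spine (F ++ l :: r :: G)) (spine (F ++ .node () l r :: G)) 0 := by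
  -- The induction walks down the right side: after `i` steps all addresses carry a prefix of `i`
  -- bits `true`, and `i + F.length` remains `n`.
  have key (n : ℕ) : ∀ (F : List BTree) (i : ℕ), i + F.length = n →
      List.Forall₂ (Maps (x n))
        ((leafAddrs (spine (F ++ l :: r :: G))).map (List.replicate i true ++ ·))
        ((leafAddrs (spine (F ++ .node () l r :: G))).map (List.replicate i true ++ ·)) := by
    intro F
    induction F with
    | nil =>
      rintro i rfl
      have h1 := (maps_x_left i).forall₂_map (leafAddrs l)
      have h2 := (maps_x_mid i).forall₂_map (leafAddrs r)
      have h3 := (maps_x_right i).forall₂_map (leafAddrs (spine G))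
      have := List.rel_append (List.rel_append h1 h2) h3
      simpa [spine, leafAddrs, Function.comp_def] using this
    | cons a F ih =>
      intro i hi
      have h1 := (maps_x_of_lt (n := n) (i := i) (by simp at hi; omega)).forall₂_map (leafAddrs a)
      have h2 := ih (i + 1) (by simp at hi; omega)
      have := List.rel_append h1 h2
      simpa [spine, leafAddrs, Function.comp_def, List.replicate_succ'] using this
  simpa [Rep] using key F.length F 0 (by simp)

/-! ### Positive elements -/

/-- The product of the powers of `x_k, x_{k+1}, …` with the given exponents. -/
def prodFrom : ℕ → List ℕ → T
  | _, [] => 1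
  | k, e :: L => x k ^ e * prodFrom (k + 1) L

lemma prodFrom_append (k : ℕ) (L L' : List ℕ) :
    prodFrom k (L ++ L') = prodFrom k L * prodFrom (k + L.length) L' := by
  induction L generalizing k with
  | nil => simp [prodFrom]
  | cons e L ih =>
    simp only [List.cons_append, prodFrom, ih, List.length_cons, mul_assoc]
    rw [show k + 1 + L.length = k + (L.length + 1) by ring]

lemma length_leafExponentsAux (t : BTree) (e : ℕ) :
    (leafExponentsAux t e).length = t.numLeaves := by
  induction t generalizing e with
  | nil => rfl
  | node _ l r hl hr => simp [leafExponentsAux, BinaryTree.numLeaves, hl, hr]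

lemma length_leafExponents (t : BTree) : (leafExponents t).length = t.numLeaves := by
  induction t with
  | nil => rfl
  | node _ l r _ hr =>
    simp [leafExponents, BinaryTree.numLeaves, length_leafExponentsAux, hr]

lemma sum_leafExponentsAux_le (t : BTree) (e : ℕ) :
    (leafExponentsAux t e).sum ≤ e + t.numNodes := by
  induction t generalizing e with
  | nil => simp [leafExponentsAux]
  | node _ l r hl hr =>
    have := hl (e + 1)
    have := hr 0
    simp only [leafExponentsAux, List.sum_append, BinaryTree.numNodes]
    omega

lemma sum_leafExponents_le (t : BTree) : (leafExponents t).sum ≤ t.numNodes := by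
  induction t with
  | nil => simp [leafExponents]
  | node _ l r _ hr =>
    have := sum_leafExponentsAux_le l 0
    simp only [leafExponents, List.sum_append, BinaryTree.numNodes]
    omega

/-- Only the exponent of the first leaf involves `e`, so the factor `x k ^ e` splits off. The
remaining `u` assembles `l` at position `k` of the right side from consecutive single leaves. -/
lemma exists_rep_leafExponentsAux (l : BTree) (k : ℕ) : ∃ u : T,
    (∀ e, prodFrom k (leafExponentsAux l e) = x k ^ e * u) ∧
      ∀ F G : List BTree, F.length = k →
        Rep u (spine (F ++ (List.replicate l.numLeaves .nil ++ G))) (spine (F ++ l :: G)) 0 := by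
  induction l generalizing k with
  | nil => exact ⟨1, fun e => by simp [leafExponentsAux, prodFrom], fun F G _ => Rep.one _⟩
  | node _ l r hl hr =>
    obtain ⟨u, hu, hu'⟩ := hl k
    obtain ⟨v, hv, hv'⟩ := hr (k + l.numLeaves)
    -- Reading from the right: `v` builds the right subtree, `u` the left one, and `x k` joins them.
    -- Building the right one first leaves the positions of the left leaves unchanged.
    refine ⟨x k * u * v, fun e => ?_, fun F G hF => ?_⟩
    · rw [leafExponentsAux, prodFrom_append, length_leafExponentsAux, hu, hv, pow_succ]
      simp [mul_assoc]
    · have h1 := hv' (F ++ List.replicate l.numLeaves .nil) G (by simp [hF])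
      have h2 := hu' F (r :: G) hF
      have h3 := rep_x F l r G
      rw [hF] at h3
      rw [List.append_assoc, List.append_assoc] at h1
      rw [BinaryTree.numLeaves, List.replicate_add, List.append_assoc]
      exact (h3.mul h2).mul h1

/-- The subtrees are assembled from right to left; `F` holds the trees before the current position,
which stay untouched. A subtree with its caret on the right side has as many carets as the subtree
has leaves. -/
lemma rep_leafExponents_spine (H F : List BTree) :
    Rep (prodFrom F.length (leafExponents (spine H)))
      (spine (F ++ List.replicate (spine H).numNodes .nil)) (spine (F ++ H)) 0 := by
  induction H generalizing F with
  | nil => simpa [prodFrom, spine, leafExponents, BinaryTree.numNodes] using Rep.one _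
  | cons l H ih =>
    obtain ⟨u, hu, hu'⟩ := exists_rep_leafExponentsAux l F.length
    have h1 := ih (F ++ List.replicate l.numLeaves .nil)
    have h2 := hu' F H rfl
    have e : (spine (l :: H)).numNodes = l.numLeaves + (spine H).numNodes := by
      rw [spine, BinaryTree.numNodes, BinaryTree.numLeaves_eq_numNodes_succ]; ring
    rw [spine, leafExponents, prodFrom_append, length_leafExponentsAux, hu, pow_zero, one_mul]
    rw [show (BinaryTree.node () l (spine H)).numNodes = _ from e, List.replicate_add]
    rw [List.append_assoc, List.append_assoc, List.length_append, List.length_replicate] at h1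
    exact h2.mul h1

lemma rep_leafExponents (t : BTree) :
    Rep (prodFrom 0 (leafExponents t)) (allRight t.numNodes) t 0 := by
  obtain ⟨F, rfl⟩ := exists_spine_eq t
  exact rep_leafExponents_spine F []

lemma prodFrom_map_range' (r : ℕ → ℕ) (k n : ℕ) :
    prodFrom k ((List.range' k n).map r) = ((List.range' k n).map fun i => x i ^ r i).prod := by
  induction n generalizing k with
  | zero => rfl
  | succ n ih => simp [List.range'_succ, prodFrom, ih]

/-- Generators with exponent zero may be inserted freely, which replaces the sorted support by an
initial segment. -/
lemma positiveElement_eq (r : ℕ →₀ ℕ) {n : ℕ} (h : r.support ⊆ Finset.range n) :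
    positiveElement r = prodFrom 0 ((List.range n).map r) := by
  have hs : r.support.sort (· ≤ ·) = (List.range n).filter (· ∈ r.support) := by
    refine List.Perm.eq_of_pairwise (le := (· ≤ ·)) (fun a b _ _ => le_antisymm)
      (Finset.pairwise_sort _ _) ?_ ?_
    · exact (List.pairwise_le_range).filter _
    · rw [List.perm_ext_iff_of_nodup (Finset.sort_nodup _ _) (List.nodup_range.filter _)]
      intro a
      simp only [Finset.mem_sort, List.mem_filter, List.mem_range, decide_eq_true_eq]
      exact ⟨fun ha => ⟨Finset.mem_range.1 (h ha), ha⟩, fun ha => ha.2⟩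
  have hp : ∀ l : List ℕ, ((l.filter (· ∈ r.support)).map fun i => x i ^ r i).prod =
      (l.map fun i => x i ^ r i).prod := by
    intro l
    induction l with
    | nil => rfl
    | cons a l ih =>
      by_cases ha : r a = 0
      · simpa [List.filter_cons, ha] using ih
      · simpa [List.filter_cons, ha] using ih
  rw [positiveElement, hs, hp, List.range_eq_range', prodFrom_map_range']

lemma map_range_toFinsupp (L : List ℕ) : (List.range L.length).map L.toFinsupp = L := by
  refine List.ext_getElem (by simp) fun k h1 h2 => ?_
  rw [List.getElem_map, List.toFinsupp_apply, List.getElem_range, List.getD_eq_getElem _ _ h2]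

lemma positiveElement_toFinsupp (L : List ℕ) : positiveElement L.toFinsupp = prodFrom 0 L := by
  rw [positiveElement_eq _ L.toFinsupp_support_subset, map_range_toFinsupp]

/-- The `pcq` factorization of any diagram represents the same element as the diagram. -/
lemma TreePair.rep_pcq (d : TreePair) : Rep d.pcq.eval d.source d.target d.mark := by
  have hn : d.source.numNodes = d.target.numNodes := by
    have := d.numLeaves_eq
    rw [BinaryTree.numLeaves_eq_numNodes_succ, BinaryTree.numLeaves_eq_numNodes_succ] at this
    omega
  have h1 := rep_leafExponents d.target
  have h2 := (rep_leafExponents d.source).inv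
  rw [hn] at h2
  have hm := d.mark_lt
  have hl : d.leaves = d.target.numNodes + 1 := d.target.numLeaves_eq_numNodes_succ
  rw [d.target.numLeaves_eq_numNodes_succ] at hm
  simp only [PCQWord.eval, pcq, positiveElement_toFinsupp]
  split_ifs with h
  · rw [h]
    simpa using h1.mul h2
  · have h3 := (rep_c (d.target.numNodes - 1)).pow (d.leaves - d.mark)
    rw [Nat.sub_add_cancel (by omega)] at h3
    have h4 : Rep (c (d.leaves - 2) ^ (d.leaves - d.mark)) (allRight d.target.numNodes)
        (allRight d.target.numNodes) d.mark := by
      rw [hl] at h3 ⊢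
      -- Each factor moves the leaves by `-1` modulo the number of leaves, so the power `d.leaves -
      -- d.mark` moves them by `d.mark`.
      refine h3.congr_mark ?_
      rw [numLeaves_allRight]
      obtain ⟨a, ha⟩ : ∃ a, d.target.numNodes = d.mark + a := ⟨_, (Nat.add_sub_of_le (by omega)).symm⟩
      rw [ha, show d.mark + a + 1 - d.mark = a + 1 by omega,
        show (a + 1) * (d.mark + a) = d.mark + a * (d.mark + a + 1) by ring,
        Nat.add_mul_mod_self_right]
    simpa using (h1.mul h4).mul h2

lemma eval_normalForm (w : T) : (normalForm w).eval = w :=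
  (reducedDiagram w).rep_pcq.unique (TreePair.represents_iff.1 (reducedDiagram_spec w).2)

/-! ### Short words -/

/-- `w` is a product of at most `n` generators from `generators` and their inverses. -/
def HasWord (w : T) (n : ℕ) : Prop :=
  ∃ l : List T, l.length ≤ n ∧ (∀ a ∈ l, a ∈ generators ∨ a⁻¹ ∈ generators) ∧ l.prod = w

namespace HasWord

variable {u w : T} {m n : ℕ}

lemma mono (h : HasWord w m) (hmn : m ≤ n) : HasWord w n :=
  let ⟨l, hl, h⟩ := h
  ⟨l, hl.trans hmn, h⟩

lemma one : HasWord 1 0 := ⟨[], by simp⟩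

lemma of_mem (h : w ∈ generators) : HasWord w 1 := ⟨[w], by simp [h]⟩

lemma mul (hu : HasWord u m) (hw : HasWord w n) : HasWord (u * w) (m + n) := by
  obtain ⟨l, hl, h, rfl⟩ := hu
  obtain ⟨l', hl', h', rfl⟩ := hw
  refine ⟨l ++ l', by simp; omega, fun a ha => ?_, by simp⟩
  exact (List.mem_append.1 ha).elim (h a) (h' a)

lemma inv (hw : HasWord w n) : HasWord w⁻¹ n := by
  obtain ⟨l, hl, h, rfl⟩ := hw
  refine ⟨(l.map (·⁻¹)).reverse, by simpa, fun a ha => ?_, (List.prod_inv_reverse l).symm⟩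
  obtain ⟨b, hb, rfl⟩ := List.mem_map.1 (List.mem_reverse.1 ha)
  simpa using (h b hb).symm

lemma pow (hw : HasWord w 1) (k : ℕ) : HasWord (w ^ k) k := by
  induction k with
  | zero => simpa using one
  | succ k ih => rw [pow_succ]; exact ih.mul hw

lemma wordLength_le (hw : HasWord w n) : wordLength generators w ≤ n := by
  obtain ⟨l, hl, h⟩ := hw
  exact le_trans (Nat.sInf_le (show l.length ∈ _ from ⟨l, rfl, h⟩)) hl

lemma mem_closure (hw : HasWord w n) : w ∈ Subgroup.closure generators := by
  obtain ⟨l, -, h, rfl⟩ := hw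
  refine Subgroup.list_prod_mem _ fun a ha => ?_
  rcases h a ha with h | h
  · exact Subgroup.subset_closure h
  · simpa using Subgroup.inv_mem _ (Subgroup.subset_closure h)

end HasWord

lemma hasWord_x_zero : HasWord (x 0) 1 := .of_mem (by simp [generators])

lemma hasWord_x_one : HasWord (x 1) 1 := .of_mem (by simp [generators])

lemma c_zero_eq : c 0 = x 0 * c 1 := by
  have h1 : Rep (x 0) (allRight 2) (.node () (.node () .nil .nil) .nil) 0 :=
    rep_x [] .nil .nil []
  have h2 : Rep (c 0) (allRight 2) (.node () (.node () .nil .nil) .nil) 2 :=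
    rep_c_zero .nil (.node () .nil .nil)
  exact h2.unique (h1.mul (rep_c 1))

lemma hasWord_c_zero : HasWord (c 0) 2 := by
  rw [c_zero_eq]
  exact hasWord_x_zero.mul (.of_mem (by simp [generators]))

/-- Joining trees `0` and `1` commutes with joining trees `k + 2` and `k + 3`, except that doing the
former first lowers the later positions by one. -/
lemma x_succ (k : ℕ) : x (k + 2) = (x 0)⁻¹ * x (k + 1) * x 0 := by
  have h1 := rep_x (.nil :: .nil :: List.replicate k .nil) .nil .nil []
  have h2 := rep_x [] .nil .nil (List.replicate k .nil ++ [.node () .nil .nil])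
  have h3 := rep_x [] .nil .nil (List.replicate k .nil ++ [.nil, .nil])
  have h4 := rep_x (.node () .nil .nil :: List.replicate k .nil) .nil .nil []
  simp only [List.length_cons, List.length_replicate, List.cons_append, List.nil_append,
    List.length_nil] at h1 h2 h3 h4
  have : x 0 * x (k + 2) = x (k + 1) * x 0 := (h2.mul h1).unique (h4.mul h3)
  rw [mul_assoc, ← this, inv_mul_cancel_left]

lemma prodFrom_succ (k : ℕ) (L : List ℕ) :
    prodFrom (k + 2) L = (x 0)⁻¹ * prodFrom (k + 1) L * x 0 := by
  induction L generalizing k with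
  | nil => simp [prodFrom]
  | cons e L ih =>
    have hp := conj_pow (i := e) (a := (x 0)⁻¹) (b := x (k + 1))
    rw [inv_inv] at hp
    rw [prodFrom, prodFrom, ih, x_succ, hp]
    group

/-- Conjugating each index down to `1` gives a product of blocks `x 1 ^ e * (x 0)⁻¹` followed by a
power of `x 0`. Cancelling that last power makes the recursion cost `e + 1` letters per step. -/
lemma hasWord_prodFrom_one (L : List ℕ) :
    HasWord (prodFrom 1 L * (x 0 ^ L.length)⁻¹) (L.sum + L.length) := by
  induction L with
  | nil => simpa [prodFrom] using HasWord.one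
  | cons e L ih =>
    have h := ((hasWord_x_one.pow e).mul hasWord_x_zero.inv).mul ih
    have h' := h.mono (n := (e :: L).sum + (e :: L).length) (by simp; omega)
    convert! h' using 1
    rw [prodFrom, prodFrom_succ, List.length_cons, pow_succ']
    group

lemma hasWord_prodFrom_zero (e : ℕ) (L : List ℕ) :
    HasWord (prodFrom 0 (e :: L)) ((e :: L).sum + 2 * L.length) := by
  have h := ((hasWord_x_zero.pow e).mul (hasWord_prodFrom_one L)).mul
    (hasWord_x_zero.pow L.length)
  have h' := h.mono (n := (e :: L).sum + 2 * L.length) (by simp; omega)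
  convert! h' using 1
  rw [prodFrom, mul_assoc, inv_mul_cancel_right]

/-- The exponent list is cut at the largest index that occurs, so trailing zero exponents cost
nothing. -/
lemma hasWord_positiveElement (r : ℕ →₀ ℕ) :
    HasWord (positiveElement r) ((r.sum fun _ e => e) + 2 * r.support.sup id) := by
  have hs : r.support ⊆ Finset.range (r.support.sup id + 1) := fun i hi =>
    Finset.mem_range.2 (Nat.lt_succ_of_le (Finset.le_sup (f := id) hi))
  have hsum : (r.sum fun _ e => e) =
      ((List.range (r.support.sup id + 1)).map r).sum := by
    rw [Finsupp.sum_of_support_subset r hs _ (fun _ _ => rfl), ← List.sum_toFinset _ List.nodup_range,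
      List.toFinset_range]
  rw [positiveElement_eq r hs, hsum, List.range_succ_eq_map, List.map_cons]
  refine (hasWord_prodFrom_zero _ _).mono ?_
  simp

/-! ### Powers of `c_n` -/

/-- The left comb with `n` carets on top of the tree `l`. -/
def comb (l : BTree) : ℕ → BTree
  | 0 => l
  | n + 1 => .node () (comb l n) .nil

lemma comb_node (l : BTree) (n : ℕ) : comb (.node () l .nil) n = comb l (n + 1) := by
  induction n with
  | zero => rfl
  | succ n ih => rw [comb, ih]; rfl

lemma rep_x_pow (F : List BTree) (l : BTree) (G : List BTree) (n : ℕ) :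
    Rep (x F.length ^ n) (spine (F ++ l :: (List.replicate n .nil ++ G)))
      (spine (F ++ comb l n :: G)) 0 := by
  induction n generalizing l with
  | zero => simpa [comb] using Rep.one _
  | succ n ih =>
    have h := (ih (.node () l .nil)).mul (rep_x F l .nil (List.replicate n .nil ++ G))
    rw [comb_node] at h
    rwa [pow_succ, List.replicate_succ]

/-- The rotation of the leaves of the all-right tree with `n + 1` carets is represented by a word
of length linear in `n`. -/
lemma hasWord_of_rep_allRight {w : T} {n m : ℕ} (hm : m ≠ 0) (hmn : m < n + 2)
    (h : Rep w (allRight (n + 1)) (allRight (n + 1)) m) : HasWord w (3 * n + 2) := by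
  obtain ⟨a, rfl⟩ := Nat.exists_eq_succ_of_ne_zero hm
  obtain ⟨b, rfl⟩ : ∃ b, n = a + b := ⟨n - a, by omega⟩
  -- With `m = a + 1`, the power `x 0 ^ b` gathers the first `b + 1` leaves into a left comb beside
  -- the all-right tree on the other `a + 1`, and `c 0` swaps the two. The inverses of `x 1 ^ (b -
  -- 1)` and of `u` then unfold the comb and the left subtree.
  obtain ⟨u, hu, hu'⟩ := exists_rep_leafExponentsAux (allRight a) 0
  have hlen : HasWord u (3 * a) := by
    have e := hu 0
    have hl := length_leafExponentsAux (allRight a) 0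
    have hs := sum_leafExponentsAux_le (allRight a) 0
    rw [numLeaves_allRight] at hl
    rw [numNodes_allRight] at hs
    obtain ⟨k, L, hL⟩ : ∃ k L, leafExponentsAux (allRight a) 0 = k :: L :=
      List.exists_cons_of_length_eq_add_one hl
    rw [hL] at e hl hs
    rw [pow_zero, one_mul] at e
    rw [← e]
    refine (hasWord_prodFrom_zero k L).mono ?_
    simp only [List.length_cons] at hl
    omega
  have h1 := hu' [] (List.replicate b .nil) rfl
  rw [numLeaves_allRight, List.nil_append, ← List.replicate_add] at h1
  have h2 : Rep (x 1 ^ (b - 1)) (spine (allRight a :: List.replicate b .nil))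
      (.node () (allRight a) (comb .nil b)) 0 := by
    cases b with
    | zero => exact Rep.one _
    | succ b =>
      have h := rep_x_pow [allRight a] .nil [] b
      rw [List.append_nil] at h
      exact h
  have h3 := rep_c_zero (comb .nil b) (allRight a)
  rw [numLeaves_allRight] at h3
  have h4 := rep_x_pow [] .nil (List.replicate a .nil) b
  have e4 : spine ([] ++ .nil :: (List.replicate b .nil ++ List.replicate a .nil)) =
      allRight (a + b + 1) := by
    rw [← List.replicate_add, List.nil_append, ← List.replicate_succ, allRight,
      add_comm b a]
  rw [e4] at h4
  have h5 := ((h1.inv.mul h2.inv).mul h3).mul h4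
  rw [show a + 1 + b = a + b + 1 by ring] at h5
  have hw : w = u⁻¹ * (x 1 ^ (b - 1))⁻¹ * c 0 * x 0 ^ b :=
    h.unique (by simpa [allRight] using h5)
  rw [hw]
  exact (((hlen.inv.mul (hasWord_x_one.pow (b - 1)).inv).mul hasWord_c_zero).mul
    (hasWord_x_zero.pow b)).mono (by omega)

/-! ### Comparison of `D`, `N` and the word length -/

lemma sum_toFinsupp (L : List ℕ) : (L.toFinsupp.sum fun _ e => e) = L.sum := by
  rw [Finsupp.sum_of_support_subset _ L.toFinsupp_support_subset _ (fun _ _ => rfl),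
    ← List.toFinset_range, List.sum_toFinset _ List.nodup_range, map_range_toFinsupp]

lemma sup_support_leafExponents_le (t : BTree) :
    (leafExponents t).toFinsupp.support.sup id ≤ t.numNodes := by
  refine Finset.sup_le fun i hi => ?_
  have := Finset.mem_range.1 (List.toFinsupp_support_subset _ hi)
  rw [length_leafExponents, BinaryTree.numLeaves_eq_numNodes_succ] at this
  exact Nat.le_of_lt_succ this

/-- Each of the five terms of the weight is at most the number of carets. -/
lemma D_le (w : T) : D w ≤ 5 * N w := by
  have hs : (reducedDiagram w).source.numNodes = N w := by
    rw [N_eq_card, ← (reducedDiagram_spec w).source_eq, card_nodeAddrs]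
  have ht : (reducedDiagram w).target.numNodes = N w := rfl
  have h1 := sum_leafExponents_le (reducedDiagram w).source
  have h2 := sum_leafExponents_le (reducedDiagram w).target
  have h3 := sup_support_leafExponents_le (reducedDiagram w).source
  have h4 := sup_support_leafExponents_le (reducedDiagram w).target
  have h5 : (normalForm w).mid.elim 0 Prod.fst ≤ N w := by
    have hl : (reducedDiagram w).leaves = N w + 1 :=
      BinaryTree.numLeaves_eq_numNodes_succ _
    simp only [normalForm, TreePair.pcq]
    split_ifs
    · simp
    · simp only [Option.elim_some, hl]; omega
  rw [D, PCQWord.weight]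
  change ((leafExponents (reducedDiagram w).target).toFinsupp.sum fun _ r => r) +
    ((leafExponents (reducedDiagram w).source).toFinsupp.sum fun _ r => r) + _ + _ + _ ≤ _
  rw [sum_toFinsupp, sum_toFinsupp]
  rw [hs] at h1 h3
  rw [ht] at h2 h4
  change (leafExponents (reducedDiagram w).target).sum + (leafExponents (reducedDiagram w).source).sum +
    (leafExponents (reducedDiagram w).target).toFinsupp.support.sup id +
    (leafExponents (reducedDiagram w).source).toFinsupp.support.sup id + _ ≤ _
  omega

/-- If the whole circle were good with image `q`, its left half would go to `q ++ [false]`, but it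
goes to `[true]`. -/
lemma N_c_zero_pos : 0 < N (c 0) := by
  rw [N_eq_card, Finset.card_pos]
  refine ⟨[], mem_badTree.2 fun q hq => ?_⟩
  have h1 := hq.append [false]
  have h2 := (maps_c_first 0).right_unique h1
  cases q <;> simp at h2

/-- The outer factors cost their exponent sum plus twice their largest index; the factor `5` is
dictated by the middle one, where `3 * i + 2 ≤ 5 * i` for `i ≥ 1`. -/
lemma hasWord_D {w : T} (hw : w ≠ c 0) : HasWord w (5 * D w) := by
  have hp := hasWord_positiveElement (normalForm w).pos
  have hn := (hasWord_positiveElement (normalForm w).neg).inv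
  have hm : HasWord ((normalForm w).mid.elim 1 fun ij => c ij.1 ^ ij.2)
      (5 * (normalForm w).mid.elim 0 Prod.fst) := by
    set d := reducedDiagram w with hd
    have hl : d.leaves = d.target.numNodes + 1 := BinaryTree.numLeaves_eq_numNodes_succ _
    have hlt : d.mark < d.leaves := d.mark_lt
    have hmid : (normalForm w).mid =
      if d.mark = 0 then none else some (d.leaves - 2, d.leaves - d.mark) := rfl
    rw [hmid]
    split_ifs with h
    · exact HasWord.one
    · obtain ⟨n, hn⟩ : ∃ n, d.leaves = n + 2 := ⟨d.leaves - 2, by omega⟩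
      -- Two leaves and a nonzero mark leave only the diagram of `c 0`.
      have hn0 : n ≠ 0 := by
        rintro rfl
        refine hw ?_
        have hone (t : BTree) (ht : t.numNodes = 1) : t = .node () .nil .nil := by
          rcases t with _ | ⟨_, l, r⟩
          · simp at ht
          · have h0 (t : BTree) (ht : t.numNodes = 0) : t = .nil := by
              cases t with
              | nil => rfl
              | node => simp [BinaryTree.numNodes] at ht
            simp only [BinaryTree.numNodes] at ht
            rw [h0 l (by omega), h0 r (by omega)]
        have hsrc := d.numLeaves_eq
        rw [BinaryTree.numLeaves_eq_numNodes_succ, BinaryTree.numLeaves_eq_numNodes_succ] at hsrc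
        have hrep := TreePair.represents_iff.1 (reducedDiagram_spec w).2
        rw [← hd, hone d.source (by omega), hone d.target (by omega),
          show d.mark = 1 by omega] at hrep
        exact hrep.unique (rep_c_zero _ _)
      simp only [Option.elim_some, hn, Nat.add_sub_cancel]
      have h3 := (rep_c n).pow (n + 2 - d.mark)
      refine (hasWord_of_rep_allRight (m := d.mark) h (by omega) (h3.congr_mark ?_)).mono
        (by omega)
      obtain ⟨a, ha⟩ : ∃ a, n + 1 = d.mark + a := ⟨n + 1 - d.mark, by omega⟩
      rw [numLeaves_allRight, show n + 2 - d.mark = a + 1 by omega, ha,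
        show (a + 1) * (d.mark + a) = d.mark + a * (d.mark + a + 1) by ring,
        Nat.add_mul_mod_self_right]
  have h := ((hp.mul hm).mul hn).mono (n := 5 * D w) (by rw [D, PCQWord.weight]; omega)
  rwa [← PCQWord.eval, eval_normalForm] at h

lemma hasWord_N (w : T) : HasWord w (25 * N w) := by
  by_cases hw : w = c 0
  · subst hw
    exact hasWord_c_zero.mono (by have := N_c_zero_pos; omega)
  · exact (hasWord_D hw).mono (by have := D_le w; omega)

lemma exists_N_le_mul_wordLength : ∃ K : ℕ, ∀ w : T, N w ≤ K * wordLength generators w := by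
  -- Letters of a word may be inverses of generators, so both caret counts enter the bound.
  let g := fun a : T => N a + N a⁻¹
  have hK (a : T) (h : a ∈ generators) : g a ≤ g (x 0) + g (x 1) + g (c 1) := by
    simp only [generators, Set.mem_insert_iff, Set.mem_singleton_iff] at h
    rcases h with rfl | rfl | rfl <;> omega
  refine ⟨g (x 0) + g (x 1) + g (c 1), fun w => ?_⟩
  have hne : {n | ∃ l : List T, l.length = n ∧ (∀ a ∈ l, a ∈ generators ∨ a⁻¹ ∈ generators) ∧
      l.prod = w}.Nonempty := by
    obtain ⟨l, -, h⟩ := hasWord_N w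
    exact ⟨l.length, l, rfl, h⟩
  obtain ⟨l, hl, h, rfl⟩ := Nat.sInf_mem hne
  rw [wordLength, ← hl]
  clear hl hne
  induction l with
  | nil => simp [N_one]
  | cons a l ih =>
    have h1 := ih fun b hb => h b (List.mem_cons_of_mem _ hb)
    have h2 := N_mul_le a l.prod
    have h3 : N a ≤ g (x 0) + g (x 1) + g (c 1) := by
      rcases h a List.mem_cons_self with h | h
      · exact (Nat.le_add_right _ _).trans (hK a h)
      · refine le_trans ?_ (hK _ h)
        simp [g]
    rw [List.prod_cons, List.length_cons, mul_add, mul_one]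
    omega

end ThompsonT

end

/-! ### The theorem -/

open ThompsonT in
theorem theorem4p1 :
    Subgroup.closure generators = ⊤ ∧
    (∀ w : T, (∃! d : TreePair, d.IsReducedDiagramOf w) ∧ (normalForm w).eval = w) ∧
    ∃ C : ℝ, 0 < C ∧ ∀ w : T,
      ((D w : ℝ) / C ≤ wordLength generators w ∧
        (w ≠ c 0 → (wordLength generators w : ℝ) ≤ C * D w)) ∧
      ((N w : ℝ) / C ≤ wordLength generators w ∧
        (wordLength generators w : ℝ) ≤ C * N w) := by
  obtain ⟨K, hK⟩ := exists_N_le_mul_wordLength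
  refine ⟨eq_top_iff.2 fun w _ => (hasWord_N w).mem_closure,
    fun w => ⟨existsUnique_reducedDiagram w, eval_normalForm w⟩,
    -- The constant dominates all four: `D ≤ 5 * N ≤ 5 * K * |w|`, `N ≤ K * |w|`, `|w| ≤ 5 * D` and
    -- `|w| ≤ 25 * N`.
    ((5 * K + 25 : ℕ) : ℝ), by positivity, fun w => ?_⟩
  have hC : (0 : ℝ) < ((5 * K + 25 : ℕ) : ℝ) := by positivity
  have hN := hK w
  have hD := D_le w
  rw [div_le_iff₀ hC, div_le_iff₀ hC]
  norm_cast
  refine ⟨⟨?_, fun hw => (hasWord_D hw).wordLength_le.trans ?_⟩, ?_,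
    (hasWord_N w).wordLength_le.trans ?_⟩ <;> nlinarith
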